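/- There are points $q_j^{(n)} \in \mathbb{C}$ ($n \in \mathbb{N}$, $1 \le j \le n$) with rational real and imaginary parts such that the map sending $n$, written in unary, to the list $q_1^{(n)},\dots,q_n^{(n)}$ is computable by a deterministic multi-stack (equivalently, multi-tape) Turing machine in time polynomial in $n$, where each point is output as the pair of its real and imaginary parts and each rational number as a fraction in lowest terms with numerator and denominator in binary, and such that for every $n$: 1. $|q_j^{(n)}| = 1$ for $j = 1,\dots,n$; 2. the only $(e_1,\dots,e_n) \in \mathbb{Z}^n$ with $(q_1^{(n)})^{e_1}\cdots (q_n^{(n)})^{e_n} = 1$ is the zero vector; 3. for every $j = 1,\dots,n$ there are integers $a_j > 0$ and $b_j$ with $a_j^2 + b_j^2 = p_j$ and $q_j^{(n)} = \dfrac{a_j + i b_j}{a_j - i b_j}$, where $p_1 < p_2 < \cdots$ are the prime numbers congruent to $1$ modulo $4$. -/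

import Mathlib

open Computability

/-- The complex number `x + i y` given by a pair `(x, y)` of rational numbers. -/
noncomputable def ratPointToComplex (z : ℚ × ℚ) : ℂ :=
  (z.1 : ℂ) + (z.2 : ℂ) * Complex.I

/-- The natural numbers in binary, as words over the standard alphabet
`blank`, `0`, `1`, `bra`, `ket`, `comma` of Turing machines. -/
def encodeNatBits (m : ℕ) : List Γ' :=
  (encodeNat m).map Γ'.bit

/-- A rational number in lowest terms: a sign bit (`1` for negative numbers), the absolute value of
the numerator in binary, a comma, and the (positive) denominator in binary. -/
def encodeRat (r : ℚ) : List Γ' :=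
  Γ'.bit (decide (r < 0)) :: encodeNatBits r.num.natAbs ++ Γ'.comma :: encodeNatBits r.den

/-- A pair of rational numbers, enclosed in brackets and separated by a comma. -/
def encodeRatPoint (z : ℚ × ℚ) : List Γ' :=
  Γ'.bra :: encodeRat z.1 ++ Γ'.comma :: (encodeRat z.2 ++ [Γ'.ket])

/-- A list of pairs of rational numbers, written one after the other. -/
def encodeRatPoints (l : List (ℚ × ℚ)) : List Γ' :=
  l.flatMap encodeRatPoint

/-- The `j`-th prime number congruent to `1` modulo `4`, counted from `j = 0` in increasing order:
`5, 13, 17, 29, …`. -/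
noncomputable def primeOneModFour (j : ℕ) : ℕ :=
  Nat.nth (fun p => p.Prime ∧ p % 4 = 1) j

theorem append_sep_inj {c : Γ'} {x x' y y' : List Γ'} (hx : c ∉ x) (hx' : c ∉ x') :
    x ++ c :: y = x' ++ c :: y' ↔ x = x' ∧ y = y' := by
  induction x generalizing x' with
  | nil => cases x' <;> simp_all
  | cons a x ih => cases x' <;> simp_all [and_assoc, eq_comm]

theorem encodeNatBits_injective : Function.Injective encodeNatBits := by
  intro m m' h
  have h' : encodeNat m = encodeNat m' :=
    List.map_injective_iff.2 (fun a b hab => by injection hab) h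
  rw [← decode_encodeNat m, h', decode_encodeNat]

theorem comma_notMem_encodeNatBits (m : ℕ) : Γ'.comma ∉ encodeNatBits m := by
  simp [encodeNatBits]

theorem ket_notMem_encodeNatBits (m : ℕ) : Γ'.ket ∉ encodeNatBits m := by
  simp [encodeNatBits]

theorem encodeRat_injective : Function.Injective encodeRat := by
  intro r s h
  simp only [encodeRat, List.cons_append, List.cons.injEq, Γ'.bit.injEq, decide_eq_decide] at h
  obtain ⟨hs, h⟩ := h
  rw [append_sep_inj (comma_notMem_encodeNatBits _)
    (comma_notMem_encodeNatBits _)] at h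
  have h1 := encodeNatBits_injective h.1
  have h2 := encodeNatBits_injective h.2
  rw [← Rat.num_neg, ← Rat.num_neg (a := s)] at hs
  exact Rat.ext (by omega) h2

/-- Different lists of points have different codes. -/
theorem encodeRatPoints_injective : Function.Injective encodeRatPoints := by
  have key : ∀ (z w : ℚ × ℚ) (u v : List Γ'),
      encodeRatPoint z ++ u = encodeRatPoint w ++ v → z = w ∧ u = v := by
    intro z w u v h
    simp only [encodeRatPoint, encodeRat, List.cons_append, List.append_assoc, List.cons.injEq,
      true_and, Γ'.bit.injEq, decide_eq_decide, List.nil_append] at h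
    obtain ⟨s1, h⟩ := h
    rw [append_sep_inj (comma_notMem_encodeNatBits _)
      (comma_notMem_encodeNatBits _)] at h
    obtain ⟨n1, h⟩ := h
    rw [append_sep_inj (comma_notMem_encodeNatBits _)
      (comma_notMem_encodeNatBits _)] at h
    obtain ⟨d1, h⟩ := h
    simp only [List.cons.injEq, Γ'.bit.injEq, decide_eq_decide] at h
    obtain ⟨s2, h⟩ := h
    rw [append_sep_inj (comma_notMem_encodeNatBits _)
      (comma_notMem_encodeNatBits _)] at h
    obtain ⟨n2, h⟩ := h
    rw [append_sep_inj (ket_notMem_encodeNatBits _)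
      (ket_notMem_encodeNatBits _)] at h
    obtain ⟨d2, h⟩ := h
    refine ⟨Prod.ext (encodeRat_injective ?_) (encodeRat_injective ?_), h⟩
    · simp only [encodeRat, n1, d1, s1]
    · simp only [encodeRat, n2, d2, s2]
  intro l
  induction l with
  | nil =>
    intro l' h
    cases l' with
    | nil => rfl
    | cons w l' => simp [encodeRatPoints, encodeRatPoint] at h
  | cons z l ih =>
    intro l' h
    cases l' with
    | nil => simp [encodeRatPoints, encodeRatPoint] at h
    | cons w l' =>
      obtain ⟨h1, h2⟩ := key z w _ _ (by simpa [encodeRatPoints] using h)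
      rw [h1, ih h2]

/-! For each prime p ≡ 1 mod 4 write p = a² + b² with 0 < b < a and take q = (a + bi)/(a - bi) =
((a² - b²) + 2abi)/p. Three independent arguments carry the theorem.

Independence: after clearing denominators, a relation between the points becomes an equation of
products in ℤ[i]. If the exponent at p_j is nonzero, reduce modulo a + b i for p_j, that is, apply a
ring homomorphism ℤ[i] → ℤ/p_j that kills a + bi. It kills neither a - bi nor the factors for the
other primes, so exactly one side vanishes (`prod_gaussian_ne`, `prod_zpow_eq_one_iff`).

Size of the primes: the j-th such prime is at most polynomial in j (`primeOneModFour_lt`). This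
follows from a Chebyshev argument: the product of 4k² + 1 over k ≤ N has logarithm at least about 2N
log N, all its prime factors are ≡ 1 mod 4, and a prime power d divides at most 2(N/d + 1) of the
factors. Too few primes would make the product too small (`sum_log_le`, `lt_card_primes`).

Computability: because the primes are polynomially bounded, all arithmetic can be done naively in
unary. Expressions with bounded sums suffice to find p, a and b by exhaustive search. They are
compiled to programs on counters, and these to a machine whose stacks are the counters in unary,
with a polynomial time bound at each stage (`Expr.runsIn_comp`, `Prog.runsIn_comp`,
`Cmd.Runs.steps`, `Prog.computableInPolyTime`). Binary enters only in the output, by repeated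
halving. -/

namespace CounterProgram

/-! ### Counter programs and their step-counting semantics -/

/-- The state of a counter program: the values of the counters, and the symbols emitted so far,
the most recent one first. -/
@[ext] structure State (ι : Type) where
  /-- the values of the counters -/
  ctr : ι → ℕ
  /-- the emitted symbols, the most recent one first -/
  out : List Γ'

namespace State

variable {ι : Type} [DecidableEq ι]

/-- Set the counter `i` to `v`. -/
def set (s : State ι) (i : ι) (v : ℕ) : State ι := ⟨Function.update s.ctr i v, s.out⟩

@[simp] theorem set_ctr (s : State ι) (i : ι) (v : ℕ) :
    (s.set i v).ctr = Function.update s.ctr i v := rfl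

@[simp] theorem set_out (s : State ι) (i : ι) (v : ℕ) : (s.set i v).out = s.out := rfl

end State

/-- Programs that increment and decrement counters and emit symbols. The command `loop i P` runs
`P` as long as the counter `i` can be decremented, after decrementing it. -/
inductive Cmd (ι : Type) : Type
  | skip : Cmd ι
  | inc (i : ι) : Cmd ι
  | dec (i : ι) : Cmd ι
  | emit (g : Γ') : Cmd ι
  | seq (P Q : Cmd ι) : Cmd ι
  | loop (i : ι) (P : Cmd ι) : Cmd ι

namespace Cmd

variable {ι κ : Type} [DecidableEq ι] [DecidableEq κ]

/-- `Runs P s t s'` says that `P` turns the state `s` into `s'` in `t` steps. -/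
inductive Runs : Cmd ι → State ι → ℕ → State ι → Prop
  | skip (s) : Runs skip s 1 s
  | inc (i s) : Runs (inc i) s 1 (s.set i (s.ctr i + 1))
  | dec (i s) : Runs (dec i) s 1 (s.set i (s.ctr i - 1))
  | emit (g s) : Runs (emit g) s 1 ⟨s.ctr, g :: s.out⟩
  | seq {P Q s s' s'' t t'} : Runs P s t s' → Runs Q s' t' s'' → Runs (seq P Q) s (t + t') s''
  | loop_zero {i P s} : s.ctr i = 0 → Runs (loop i P) s 1 s
  | loop_succ {i P s s' s'' t t' k} : s.ctr i = k + 1 → Runs P (s.set i k) t s' →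
      Runs (loop i P) s' t' s'' → Runs (loop i P) s (t + t' + 1) s''

/-- The counters that a program mentions. -/
def vars : Cmd ι → Finset ι
  | skip => ∅
  | inc i => {i}
  | dec i => {i}
  | emit _ => ∅
  | seq P Q => P.vars ∪ Q.vars
  | loop i P => insert i P.vars

/-- Rename the counters of a program. -/
def map (f : ι → κ) : Cmd ι → Cmd κ
  | skip => skip
  | inc i => inc (f i)
  | dec i => dec (f i)
  | emit g => emit g
  | seq P Q => seq (P.map f) (Q.map f)
  | loop i P => loop (f i) (P.map f)

/-- A run touches only the counters it mentions, so it can be restricted along `h`. This is used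
with `h` the inclusion of a finite set of counters, since a machine has only finitely many stacks.
-/
theorem Runs.map {f : ι → κ} {h : κ → ι} (hh : Function.Injective h) {P : Cmd ι} {s s' : State ι}
    {t : ℕ} (r : Runs P s t s') (hP : ∀ i ∈ P.vars, h (f i) = i) :
    Runs (P.map f) ⟨s.ctr ∘ h, s.out⟩ t ⟨s'.ctr ∘ h, s'.out⟩ := by
  have key : ∀ (s : State ι) (i : ι) (v : ℕ), h (f i) = i →
      (⟨(s.set i v).ctr ∘ h, (s.set i v).out⟩ : State κ)
        = (⟨s.ctr ∘ h, s.out⟩ : State κ).set (f i) v := by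
    intro s i v hi
    ext j
    · by_cases hj : j = f i
      · subst hj; simp [hi]
      · have : h j ≠ i := fun e => hj (hh (e.trans hi.symm))
        simp [Function.update_of_ne, hj, this]
    · rfl
  induction r with
  | skip s => exact .skip _
  | inc i s =>
    have hi := hP i (by simp [vars])
    rw [key _ _ _ hi]
    simpa [hi, Cmd.map] using Runs.inc (f i) (⟨s.ctr ∘ h, s.out⟩ : State κ)
  | dec i s =>
    have hi := hP i (by simp [vars])
    rw [key _ _ _ hi]
    simpa [hi, Cmd.map] using Runs.dec (f i) (⟨s.ctr ∘ h, s.out⟩ : State κ)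
  | emit g s => exact .emit g _
  | seq _ _ ih1 ih2 =>
    exact .seq (ih1 fun i hi => hP i (by simp [vars, hi]))
      (ih2 fun i hi => hP i (by simp [vars, hi]))
  | @loop_zero i P s h0 =>
    have hi := hP i (by simp [vars])
    exact .loop_zero (by simpa [hi] using h0)
  | @loop_succ i P s s' s'' t t' k h0 _ _ ih1 ih2 =>
    have hi := hP i (by simp [vars])
    refine .loop_succ (k := k) (by simpa [hi] using h0) ?_ (ih2 hP)
    rw [← key _ _ _ hi]
    exact ih1 fun j hj => hP j (by simp [vars, hj])

theorem Runs.ctr_le {P : Cmd ι} {s s' : State ι} {t : ℕ} (r : Runs P s t s') (j : ι) :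
    s'.ctr j ≤ s.ctr j + t := by
  induction r with
  | skip s => simp
  | inc i s =>
    by_cases h : j = i
    · subst h; simp
    · simp [h]
  | dec i s =>
    by_cases h : j = i
    · subst h; simp; omega
    · simp [h]
  | emit g s => simp
  | seq _ _ ih1 ih2 => omega
  | loop_zero h0 => omega
  | @loop_succ i P s s' s'' t t' k h0 _ _ ih1 ih2 =>
    by_cases h : j = i
    · subst h; simp at ih1; omega
    · simp [h] at ih1; omega

/-- Set all counters in a list to zero. -/
def clear : List ι → Cmd ι
  | [] => skip
  | i :: l => seq (loop i skip) (clear l)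

theorem runs_loop_skip (i : ι) (s : State ι) :
    Runs (loop i skip) s (2 * s.ctr i + 1) (s.set i 0) := by
  obtain ⟨k, hk⟩ : ∃ k, s.ctr i = k := ⟨_, rfl⟩
  induction k generalizing s with
  | zero =>
    have : s.set i 0 = s := by ext j <;> simp [← hk]
    rw [this, hk]
    exact .loop_zero hk
  | succ k ih =>
    have h := ih (s.set i k) (by simp)
    have h2 := Runs.loop_succ hk (.skip _) h
    convert h2 using 1
    · simp; omega
    · ext j <;> simp

theorem runs_clear (l : List ι) (s : State ι) (B : ℕ) (hB : ∀ i, s.ctr i ≤ B) :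
    ∃ t ≤ l.length * (2 * B + 1) + 1, ∃ s', Runs (clear l) s t s' ∧ s'.out = s.out ∧
      ∀ i, s'.ctr i = if i ∈ l then 0 else s.ctr i := by
  induction l generalizing s with
  | nil => exact ⟨1, by simp, s, .skip s, rfl, by simp⟩
  | cons i l ih =>
    obtain ⟨t, ht, s', hr, ho, hc⟩ := ih (s.set i 0) (fun j => by
      by_cases h : j = i
      · subst h; simp
      · simpa [h] using hB j)
    refine ⟨_, ?_, s', .seq (runs_loop_skip i s) hr, by simpa using ho, ?_⟩
    · have := hB i
      simp only [List.length_cons, add_mul]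
      omega
    · intro j
      rw [hc]
      by_cases h : j = i
      · subst h; simp
      · simp [h]

/-! ### Compilation to machines with several stacks -/

/-- The stack alphabets: counters are stacks of Booleans, the two other stacks hold symbols. -/
def Alph (ι : Type) : ι ⊕ Bool → Type
  | Sum.inl _ => Bool
  | Sum.inr _ => Γ'

/-- The labels of the machine that belong to a program. -/
def Lab : Cmd ι → Type
  | skip => Unit
  | inc _ => Unit
  | dec _ => Unit
  | emit _ => Unit
  | seq P Q => P.Lab ⊕ Q.Lab
  | loop _ P => Option P.Lab

/-- A program has finitely many labels. -/
@[reducible] def labFintype : (P : Cmd ι) → Fintype P.Lab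
  | skip => inferInstanceAs (Fintype Unit)
  | inc _ => inferInstanceAs (Fintype Unit)
  | dec _ => inferInstanceAs (Fintype Unit)
  | emit _ => inferInstanceAs (Fintype Unit)
  | seq P Q =>
    letI := P.labFintype
    letI := Q.labFintype
    inferInstanceAs (Fintype (P.Lab ⊕ Q.Lab))
  | loop _ P =>
    letI := P.labFintype
    inferInstanceAs (Fintype (Option P.Lab))

instance (P : Cmd ι) : Fintype P.Lab := P.labFintype

/-- The label at which the execution of a program starts. -/
def entry : (P : Cmd ι) → P.Lab
  | skip => ()
  | inc _ => ()
  | dec _ => ()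
  | emit _ => ()
  | seq P _ => Sum.inl P.entry
  | loop _ _ => none

open Turing TM2.Stmt

/-- The code of a program whose labels are embedded into `Λ` by `emb` and which continues at the
label `e`. -/
def code {Λ : Type} : (P : Cmd ι) → (P.Lab → Λ) → Λ → P.Lab →
    TM2.Stmt (Alph ι) Λ (Option Γ')
  | skip, _, e, _ => goto fun _ => e
  | inc i, _, e, _ => push (Sum.inl i) (fun _ => true) (goto fun _ => e)
  | dec i, _, e, _ => pop (Sum.inl i) (fun v _ => v) (goto fun _ => e)
  | emit g, _, e, _ => push (Sum.inr false) (fun _ => g) (goto fun _ => e)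
  | seq P Q, emb, e, l =>
    Sum.elim (P.code (emb ∘ Sum.inl) (emb (Sum.inr Q.entry))) (Q.code (emb ∘ Sum.inr) e) l
  | loop i P, emb, e, l =>
    Option.elim l
      (pop (Sum.inl i) (fun _ o => o.map fun _ => Γ'.blank)
        (branch Option.isSome
          (load (fun _ => none) (goto fun _ => emb (some P.entry))) (goto fun _ => e)))
      (P.code (emb ∘ some) (emb none))

/-- The stacks that represent a state. -/
def stackOf (s : State ι) : ∀ k : ι ⊕ Bool, List (Alph ι k)
  | Sum.inl i => List.replicate (s.ctr i) true
  | Sum.inr false => s.out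
  | Sum.inr true => []

theorem stackOf_set (s : State ι) (i : ι) (v : ℕ) :
    stackOf (s.set i v) = Function.update (stackOf s) (Sum.inl i) (List.replicate v true) := by
  funext k
  rcases k with j | b
  · by_cases h : j = i
    · subst h; simp [stackOf]
    · simp [stackOf, h]
  · cases b <;> rfl

/-- `t` steps of a machine. -/
def Steps {K Λ σ : Type} [DecidableEq K] {Γ : K → Type} (M : Λ → TM2.Stmt Γ Λ σ) (t : ℕ)
    (c c' : TM2.Cfg Γ Λ σ) : Prop :=
  (flip bind (TM2.step M))^[t] (some c) = some c'

theorem Steps.trans {K Λ σ : Type} [DecidableEq K] {Γ : K → Type} {M : Λ → TM2.Stmt Γ Λ σ}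
    {t t' : ℕ} {c c' c'' : TM2.Cfg Γ Λ σ} (h : Steps M t c c') (h' : Steps M t' c' c'') :
    Steps M (t + t') c c'' := by
  unfold Steps at *
  rw [add_comm, Function.iterate_add_apply, h, h']

theorem Steps.single {K Λ σ : Type} [DecidableEq K] {Γ : K → Type} {M : Λ → TM2.Stmt Γ Λ σ}
    {l : Λ} {v : σ} {S} {c' : TM2.Cfg Γ Λ σ} (h : TM2.stepAux (M l) v S = c') :
    Steps M 1 ⟨some l, v, S⟩ c' := by
  simp [Steps, flip, h]

/-- The costs in `Runs` are chosen so that one unit is exactly one machine step. The internal state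
is `none` between commands; a loop test sets it to `some` if its pop succeeds, and the branch resets
it. Popping an empty stack matches truncated decrement. -/
theorem Runs.steps {Λ : Type} {M : Λ → TM2.Stmt (Alph ι) Λ (Option Γ')} {P : Cmd ι}
    {s s' : State ι} {t : ℕ} (r : Runs P s t s') (emb : P.Lab → Λ) (e : Λ)
    (hM : ∀ l, M (emb l) = P.code emb e l) :
    Steps M t ⟨some (emb P.entry), none, stackOf s⟩ ⟨some e, none, stackOf s'⟩ := by
  induction r generalizing e with
  | skip s => exact Steps.single (by rw [hM]; simp [code])
  | inc i s =>
    refine Steps.single ?_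
    rw [hM, stackOf_set]
    rfl
  | dec i s =>
    refine Steps.single ?_
    rw [hM, stackOf_set]
    exact congrArg (fun l => TM2.Cfg.mk (some e) none (Function.update (stackOf s) (Sum.inl i) l))
      (List.tail_replicate (a := true))
  | emit g s =>
    refine Steps.single ?_
    rw [hM]
    simp only [code, TM2.stepAux, TM2.Cfg.mk.injEq, true_and]
    funext k
    rcases k with j | b
    · rfl
    · cases b <;> rfl
  | @seq P Q s s' s'' t t' _ _ ih1 ih2 =>
    exact (ih1 (emb ∘ Sum.inl) (emb (Sum.inr Q.entry)) fun l => hM (Sum.inl l)).trans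
      (ih2 (emb ∘ Sum.inr) e fun l => hM (Sum.inr l))
  | @loop_zero i P s h0 =>
    refine Steps.single ?_
    have h := stackOf_set s i 0
    have hs : s.set i 0 = s := by ext j <;> simp [← h0]
    rw [hs] at h
    have h' : stackOf s (Sum.inl i) = [] := congrArg (List.replicate · true) h0
    rw [hM]
    simp only [code, entry, Option.elim_none, TM2.stepAux, h']
    exact congrArg (TM2.Cfg.mk (some e) none) h.symm
  | @loop_succ i P s s' s'' t t' k h0 _ _ ih1 ih2 =>
    have h1 : Steps M 1 ⟨some (emb (entry (loop i P))), none, stackOf s⟩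
        ⟨some (emb (some P.entry)), none, stackOf (s.set i k)⟩ := by
      refine Steps.single ?_
      have h' : stackOf s (Sum.inl i) = (true :: List.replicate k true : List Bool) :=
        congrArg (List.replicate · true) h0
      rw [hM, stackOf_set]
      simp only [code, entry, Option.elim_none, TM2.stepAux, h']
      rfl
    have := (h1.trans (ih1 (emb ∘ some) (emb none) fun l => hM (some l))).trans (ih2 emb e hM)
    convert this using 1
    omega

/-- The code of the machine for a program: after the program, the emitted symbols are moved to the
output stack. -/
def machineCode (P : Cmd ι) : Option P.Lab → TM2.Stmt (Alph ι) (Option P.Lab) (Option Γ')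
  | none =>
    pop (Sum.inr false) (fun _ o => o)
      (branch Option.isSome
        (push (Sum.inr true) (fun v => v.getD Γ'.blank)
          (load (fun _ => none) (goto fun _ => none))) halt)
  | some l => P.code some none l

/-- The stacks when the program has ended and all counters are zero. -/
def flushStacks (l l' : List Γ') : ∀ k : ι ⊕ Bool, List (Alph ι k)
  | Sum.inl _ => []
  | Sum.inr false => l
  | Sum.inr true => l'

theorem flush_steps (P : Cmd ι) (l l' : List Γ') :
    Steps P.machineCode (l.length + 1) ⟨some none, none, flushStacks l l'⟩
      ⟨none, none, flushStacks [] (l.reverse ++ l')⟩ := by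
  induction l generalizing l' with
  | nil =>
    have h : Function.update (flushStacks (ι := ι) [] l') (Sum.inr false) [] =
        flushStacks [] l' := by
      funext k
      rcases k with j | b
      · rfl
      · cases b <;> rfl
    exact Steps.single (congrArg (TM2.Cfg.mk none none) h)
  | cons g l ih =>
    have h1 : Steps P.machineCode 1 ⟨some none, none, flushStacks (g :: l) l'⟩
        ⟨some none, none, flushStacks l (g :: l')⟩ := by
      have h : Function.update (Function.update (flushStacks (ι := ι) (g :: l) l')
          (Sum.inr false) l) (Sum.inr true) (g :: l') = flushStacks l (g :: l') := by
        funext k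
        rcases k with j | b
        · rfl
        · cases b <;> rfl
      exact Steps.single (congrArg (TM2.Cfg.mk (some none) none) h)
    have := h1.trans (ih (g :: l'))
    simp only [List.reverse_cons, List.append_assoc, List.singleton_append, List.length_cons]
    convert this using 1
    omega

/-- The machine for a program: its input is the initial value of the counter `i₀`, in unary. -/
def machine [Fintype ι] (i₀ : ι) (P : Cmd ι) : FinTM2 where
  K := ι ⊕ Bool
  k₀ := Sum.inl i₀
  k₁ := Sum.inr true
  Γ := Alph ι
  Λ := Option P.Lab
  main := some P.entry
  σ := Option Γ'
  initialState := none
  Γk₀Fin := inferInstanceAs (Fintype Bool)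
  m := P.machineCode

theorem Runs.out_length_le {P : Cmd ι} {s s' : State ι} {t : ℕ} (r : Runs P s t s') :
    s'.out.length ≤ s.out.length + t := by
  induction r with
  | skip s => simp
  | inc i s => simp
  | dec i s => simp
  | emit g s => simp
  | seq _ _ ih1 ih2 => omega
  | loop_zero h0 => omega
  | loop_succ h0 _ _ ih1 ih2 => rw [State.set_out] at ih1; omega

theorem unaryEncodeNat_eq_replicate (n : ℕ) : unaryEncodeNat n = List.replicate n true := by
  induction n with
  | zero => rfl
  | succ n ih => rw [unaryEncodeNat, ih, List.replicate_succ]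

/-- The state with the value `n` in the counter `i₀`. -/
def initState (i₀ : ι) (n : ℕ) : State ι := ⟨Function.update (fun _ => 0) i₀ n, []⟩

theorem machine_initList [Fintype ι] (i₀ : ι) (P : Cmd ι) (n : ℕ) :
    initList (machine i₀ P) (List.replicate n true : List Bool) =
      ⟨some (some P.entry), none, stackOf (initState i₀ n)⟩ := by
  unfold initList
  refine congrArg (TM2.Cfg.mk _ _) ?_
  funext k
  rcases k with j | b
  · by_cases h : j = i₀
    · subst h
      refine (dif_pos rfl).trans ?_
      have : (initState j n).ctr j = n := by simp [initState]
      exact congrArg (List.replicate · true) this.symm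
    · refine (dif_neg fun e => h (Sum.inl_injective e)).trans ?_
      have : (initState i₀ n).ctr j = 0 := by simp [initState, h]
      exact congrArg (List.replicate · true) this.symm
  · refine (dif_neg Sum.inr_ne_inl).trans ?_
    cases b <;> rfl

theorem machine_haltList [Fintype ι] (i₀ : ι) (P : Cmd ι) (l : List Γ') :
    haltList (machine i₀ P) l = ⟨none, none, flushStacks [] l⟩ := by
  unfold haltList
  refine congrArg (TM2.Cfg.mk _ _) ?_
  funext k
  rcases k with j | b
  · exact dif_neg Sum.inl_ne_inr
  · cases b
    · exact dif_neg fun e => Bool.noConfusion (Sum.inr_injective e)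
    · exact dif_pos rfl

theorem Runs.machine_steps [Fintype ι] {P : Cmd ι} {i₀ : ι} {n t : ℕ} {s' : State ι}
    (r : Runs P (initState i₀ n) t s') (h : ∀ i, s'.ctr i = 0) :
    Steps (machine i₀ P).m (t + (s'.out.length + 1))
      ⟨some (some P.entry), none, stackOf (initState i₀ n)⟩
      ⟨none, none, flushStacks [] s'.out.reverse⟩ := by
  have h1 := r.steps (M := P.machineCode) some none fun _ => rfl
  have h2 := flush_steps P s'.out []
  have h3 : stackOf s' = flushStacks s'.out [] := by
    funext k
    rcases k with j | b
    · exact congrArg (List.replicate · true) (h j)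
    · cases b <;> rfl
  rw [h3] at h1
  have := h1.trans h2
  rwa [List.append_nil] at this

/-- A function of a natural number in unary is computable in polynomial time if a counter program
emits its values in polynomial time. -/
theorem computableInPolyTime_of_runs {β : Type} {f : ℕ → β} {eb : β → List Γ'} (P : Cmd ι)
    (i₀ : ι) (p : Polynomial ℕ)
    (h : ∀ n, ∃ t ≤ p.eval n, ∃ s', Runs P (initState i₀ n) t s' ∧ s'.out.reverse = eb (f n)) :
    Nonempty (TM2ComputableInPolyTime unaryEncodeNat eb f) := by
  classical
  -- `FinTM2` needs a finite set of stacks, so only the counters that occur are kept, together with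
  -- the input counter.
  let F : Finset ι := insert i₀ P.vars
  let g : ι → F := fun i => if hi : i ∈ F then ⟨i, hi⟩ else ⟨i₀, Finset.mem_insert_self _ _⟩
  have hg : ∀ i ∈ F, (g i : ι) = i := fun i hi => by simp [g, hi]
  let c : ℕ := (Finset.univ : Finset F).toList.length
  -- The halting configuration `haltList` requires all stacks other than the output stack to be
  -- empty.
  let Q : Cmd F := seq (P.map g) (clear Finset.univ.toList)
  have key : ∀ n, ∃ t ≤ p.eval n + (c * (2 * (n + p.eval n) + 1) + 1) + (p.eval n + 1),
      Steps (machine (g i₀) Q).m t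
        ⟨some (some Q.entry), none, stackOf (initState (g i₀) n)⟩
        ⟨none, none, flushStacks [] (eb (f n))⟩ := by
    intro n
    obtain ⟨t, ht, s', hr, ho⟩ := h n
    have hr' := hr.map (f := g) Subtype.val_injective fun i hi => hg i (Finset.mem_insert_of_mem hi)
    have hi : (⟨(initState i₀ n).ctr ∘ Subtype.val, (initState i₀ n).out⟩ : State F)
        = initState (g i₀) n := by
      ext j
      · have h0 := hg i₀ (Finset.mem_insert_self _ _)
        simp only [initState, Function.comp_apply, Function.update_apply]
        refine if_congr ?_ rfl rfl
        rw [← Subtype.val_inj, h0]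
      · rfl
    rw [hi] at hr'
    -- Each counter starts at most at `n` and grows by at most one per step, which bounds the cost
    -- of clearing.
    obtain ⟨t2, ht2, s2, hr2, ho2, hc2⟩ := runs_clear (Finset.univ : Finset F).toList
      ⟨s'.ctr ∘ Subtype.val, s'.out⟩ (n + p.eval n) fun i => by
        have := hr.ctr_le i
        have h2 : (initState i₀ n).ctr i ≤ n := by
          simp only [initState, Function.update_apply]
          split <;> simp
        simp only [Function.comp_apply]
        omega
    have := (Runs.seq hr' hr2).machine_steps (i₀ := g i₀) (n := n) fun i => by simp [hc2]
    rw [ho2, ho] at this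
    have hl := hr.out_length_le
    simp only [initState, List.length_nil] at hl
    refine ⟨_, ?_, this⟩
    refine Nat.add_le_add (Nat.add_le_add ht ht2) ?_
    dsimp only
    omega
  refine ⟨⟨⟨machine (g i₀) Q, Equiv.refl _, Equiv.refl _⟩,
    p + (Polynomial.C c * (2 * (Polynomial.X + p) + 1) + 1) + (p + 1), fun n => ?_⟩⟩
  have hk := key n
  refine ⟨⟨hk.choose, ?_⟩, ?_⟩
  · have := hk.choose_spec.2
    have e1 : List.map (Equiv.refl Bool).invFun (unaryEncodeNat n) = List.replicate n true := by
      rw [unaryEncodeNat_eq_replicate]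
      exact List.map_id _
    have e2 : List.map (Equiv.refl Γ').invFun (eb (f n)) = eb (f n) := List.map_id _
    have e3 := machine_initList (g i₀) Q n
    rw [← e1] at e3
    have e4 := machine_haltList (g i₀) Q (eb (f n))
    unfold Steps at this
    refine Eq.trans (congrArg _ (congrArg some e3)) (Eq.trans this ?_)
    exact congrArg some (e4.symm.trans (congrArg (haltList (machine (g i₀) Q)) e2.symm))
  · have := hk.choose_spec.1
    have hl : (unaryEncodeNat n).length = n := by
      rw [unaryEncodeNat_eq_replicate, List.length_replicate]
    refine le_of_le_of_eq this ?_
    rw [hl]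
    simp

end Cmd

/-! ### Runs with an upper bound on the time -/

theorem Cmd.Runs.of_eq {ι : Type} [DecidableEq ι] {P : Cmd ι} {s s' s'' : State ι} {t t' : ℕ}
    (r : Cmd.Runs P s t s') (ht : t = t') (hs : s' = s'') : Cmd.Runs P s t' s'' := by
  subst ht hs; exact r

/-- `RunsIn P s T s'` says that `P` turns the state `s` into `s'` in at most `T` steps. -/
def RunsIn {ι : Type} [DecidableEq ι] (P : Cmd ι) (s : State ι) (T : ℕ) (s' : State ι) : Prop :=
  ∃ t ≤ T, Cmd.Runs P s t s'

namespace RunsIn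

variable {ι : Type} [DecidableEq ι]

theorem mono {P : Cmd ι} {s s' s'' : State ι} {T T' : ℕ} (h : RunsIn P s T s') (hT : T ≤ T')
    (hs : s' = s'') : RunsIn P s T' s'' := by
  obtain ⟨t, ht, hr⟩ := h
  exact ⟨t, ht.trans hT, hs ▸ hr⟩

theorem seq {P Q : Cmd ι} {s s' s'' : State ι} {T T' : ℕ} (h : RunsIn P s T s')
    (h' : RunsIn Q s' T' s'') : RunsIn (.seq P Q) s (T + T') s'' := by
  obtain ⟨t, ht, hr⟩ := h
  obtain ⟨t', ht', hr'⟩ := h'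
  exact ⟨t + t', add_le_add ht ht', .seq hr hr'⟩

/-- The rule for loops with a given sequence of intermediate states. -/
theorem loop {i : ι} {P : Cmd ι} (N : ℕ) (σ : ℕ → State ι) (T : ℕ → ℕ)
    (h0 : ∀ k ≤ N, (σ k).ctr i = N - k)
    (h : ∀ k < N, RunsIn P ((σ k).set i (N - (k + 1))) (T k) (σ (k + 1))) :
    RunsIn (.loop i P) (σ 0) (∑ k ∈ Finset.range N, (T k + 1) + 1) (σ N) := by
  induction N generalizing σ T with
  | zero => exact ⟨1, by simp, .loop_zero (by simpa using h0 0 le_rfl)⟩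
  | succ N ih =>
    obtain ⟨t, ht, hr⟩ := h 0 (by omega)
    obtain ⟨t', ht', hr'⟩ := ih (fun k => σ (k + 1)) (fun k => T (k + 1))
      (fun k hk => by rw [h0 (k + 1) (by omega)]; omega)
      (fun k hk => by
        have := h (k + 1) (by omega)
        rwa [show N + 1 - (k + 1 + 1) = N - (k + 1) by omega] at this)
    refine ⟨t + t' + 1, ?_, .loop_succ (k := N) (by simpa using h0 0 (by omega))
      (by simpa using hr) hr'⟩
    rw [Finset.sum_range_succ']
    omega

theorem loop_skip (i : ι) (s : State ι) :
    RunsIn (.loop i .skip) s (2 * s.ctr i + 1) (s.set i 0) :=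
  ⟨_, le_rfl, Cmd.runs_loop_skip i s⟩

theorem loop_inc {i j : ι} (hij : i ≠ j) (s : State ι) :
    RunsIn (.loop i (.inc j)) s (2 * s.ctr i + 1)
      ((s.set i 0).set j (s.ctr j + s.ctr i)) := by
  have := loop (i := i) (P := .inc j) (s.ctr i)
    (fun k => (s.set i (s.ctr i - k)).set j (s.ctr j + k)) (fun _ => 1)
    (fun k _ => by simp [hij]) (fun k hk => ⟨1, le_rfl, ?_⟩)
  · have hs : (s.set i (s.ctr i - 0)).set j (s.ctr j + 0) = s := by ext l <;> simp
    rw [hs] at this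
    exact this.mono (by simp; omega) (by simp)
  · refine (Cmd.Runs.inc j _).of_eq rfl ?_
    ext l
    · simp only [State.set_ctr, Function.update_apply]
      split_ifs <;> simp_all <;> omega
    · simp

end RunsIn

/-! ### Arithmetic expressions -/

/-- Arithmetic expressions with bounded sums. -/
inductive Expr : Type
  | var (v : ℕ) : Expr
  | const (c : ℕ) : Expr
  | add (e f : Expr) : Expr
  | mul (e f : Expr) : Expr
  | sub (e f : Expr) : Expr
  | sum (v : ℕ) (e f : Expr) : Expr

namespace Expr

/-- The value of an expression. -/
def eval : Expr → (ℕ → ℕ) → ℕ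
  | var v, a => a v
  | const c, _ => c
  | add e f, a => e.eval a + f.eval a
  | mul e f, a => e.eval a * f.eval a
  | sub e f, a => e.eval a - f.eval a
  | sum v e f, a => ∑ i ∈ Finset.range (e.eval a), f.eval (Function.update a v i)

/-- A time bound for the evaluation of an expression. -/
def cost : Expr → (ℕ → ℕ) → ℕ
  | var v, a => 5 * a v + 2
  | const c, _ => c + 1
  | add e f, a => e.cost a + f.cost a
  | mul e f, a => e.cost a + (e.eval a * (f.cost a + 1) + 1)
  | sub e f, a => e.cost a + (f.cost a + (2 * f.eval a + 1 + (2 * e.eval a + 1)))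
  | sum v e f, a =>
    e.cost a + (2 * a v + 1 +
      (∑ i ∈ Finset.range (e.eval a), (f.cost (Function.update a v i) + 1 + 1) + 1 +
        (2 * e.eval a + 1 + (2 * a v + 1))))

open Cmd in
/-- The program that adds a constant to a counter. -/
def addConst (x : ℕ) : ℕ → Cmd (ℕ ⊕ ℕ)
  | 0 => skip
  | c + 1 => seq (addConst x c) (inc (.inr x))

open Cmd in
/-- The program that adds the value of an expression to the auxiliary counter `x`, using the
auxiliary counters from `w` on. -/
def comp : Expr → ℕ → ℕ → Cmd (ℕ ⊕ ℕ)
  | var v, x, w =>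
    seq (loop (.inl v) (seq (inc (.inr x)) (inc (.inr w)))) (loop (.inr w) (inc (.inl v)))
  | const c, x, _ => addConst x c
  | add e f, x, w => seq (e.comp x w) (f.comp x w)
  | mul e f, x, w => seq (e.comp w (w + 1)) (loop (.inr w) (f.comp x (w + 1)))
  | sub e f, x, w =>
    seq (e.comp w (w + 1)) (seq (f.comp (w + 1) (w + 2))
      (seq (loop (.inr (w + 1)) (dec (.inr w))) (loop (.inr w) (inc (.inr x)))))
  | sum v e f, x, w =>
    seq (e.comp w (w + 2)) (seq (loop (.inl v) (inc (.inr (w + 1))))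
      (seq (loop (.inr w) (seq (f.comp x (w + 2)) (inc (.inl v))))
        (seq (loop (.inl v) skip) (loop (.inr (w + 1)) (inc (.inl v))))))

end Expr

/-- The state with given values of the named and of the auxiliary counters. -/
def pairState (a b : ℕ → ℕ) (o : List Γ') : State (ℕ ⊕ ℕ) := ⟨Sum.elim a b, o⟩

section pairState

variable (a b : ℕ → ℕ) (o : List Γ')

@[simp] theorem pairState_inl (v : ℕ) : (pairState a b o).ctr (.inl v) = a v := rfl

@[simp] theorem pairState_inr (x : ℕ) : (pairState a b o).ctr (.inr x) = b x := rfl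

@[simp] theorem pairState_set_inl (v n : ℕ) :
    (pairState a b o).set (.inl v) n = pairState (Function.update a v n) b o := by
  ext j
  · rcases j with j | j <;>
      simp only [pairState, State.set_ctr, Function.update_apply, Sum.elim_inl, Sum.elim_inr,
        Sum.inl.injEq, reduceCtorEq, if_false]
  · rfl

@[simp] theorem pairState_set_inr (x n : ℕ) :
    (pairState a b o).set (.inr x) n = pairState a (Function.update b x n) o := by
  ext j
  · rcases j with j | j <;>
      simp only [pairState, State.set_ctr, Function.update_apply, Sum.elim_inl, Sum.elim_inr,
        Sum.inr.injEq, reduceCtorEq, if_false]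
  · rfl

theorem runsIn_inc_inl (v : ℕ) :
    RunsIn (.inc (.inl v)) (pairState a b o) 1 (pairState (Function.update a v (a v + 1)) b o) :=
  ⟨1, le_rfl, (Cmd.Runs.inc _ _).of_eq rfl (by simp)⟩

theorem runsIn_inc_inr (x : ℕ) :
    RunsIn (.inc (.inr x)) (pairState a b o) 1 (pairState a (Function.update b x (b x + 1)) o) :=
  ⟨1, le_rfl, (Cmd.Runs.inc _ _).of_eq rfl (by simp)⟩

theorem runsIn_dec_inr (x : ℕ) :
    RunsIn (.dec (.inr x)) (pairState a b o) 1 (pairState a (Function.update b x (b x - 1)) o) :=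
  ⟨1, le_rfl, (Cmd.Runs.dec _ _).of_eq rfl (by simp)⟩

end pairState

namespace Expr

theorem runsIn_addConst (x c : ℕ) (a b : ℕ → ℕ) (o : List Γ') :
    RunsIn (addConst x c) (pairState a b o) (c + 1)
      (pairState a (Function.update b x (b x + c)) o) := by
  induction c with
  | zero => exact ⟨1, le_rfl, (Cmd.Runs.skip _).of_eq rfl (by simp)⟩
  | succ c ih =>
    refine (ih.seq (runsIn_inc_inr _ _ _ x)).mono le_rfl ?_
    simp [add_assoc]

/-- The invariant is that the auxiliary counters from `w` on are zero before and after, and that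
named variables are restored. Reading a variable empties it, so a copy is kept in `w` and moved
back; a sum saves its bound variable in `w + 1` and lets the variable itself run as the index.
Adding to `x` instead of overwriting it makes sums and products mere repetition. -/
theorem runsIn_comp (e : Expr) : ∀ (x w : ℕ) (a b : ℕ → ℕ) (o : List Γ'), x < w →
    (∀ j, w ≤ j → b j = 0) → RunsIn (e.comp x w) (pairState a b o) (e.cost a)
      (pairState a (Function.update b x (b x + e.eval a)) o) := by
  induction e with
  | var v =>
    intro x w a b o hx hb
    have h1 := RunsIn.loop (i := .inl v) (P := .seq (.inc (.inr x)) (.inc (.inr w))) (a v)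
      (fun k => pairState (Function.update a v (a v - k))
        (Function.update (Function.update b x (b x + k)) w k) o) (fun _ => 1 + 1)
      (fun k _ => by simp) (fun k hk => by
        rw [pairState_set_inl]
        refine ((runsIn_inc_inr _ _ _ x).seq (runsIn_inc_inr _ _ _ w)).mono le_rfl ?_
        have : w ≠ x := by omega
        congr 1
        · simp
        · funext j
          simp only [Function.update_apply]
          split_ifs <;> simp_all <;> omega)
    have hs : pairState a b o = pairState (Function.update a v (a v - 0))
        (Function.update (Function.update b x (b x + 0)) w 0) o := by
      congr 1
      · simp
      · funext j
        have := hb w le_rfl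
        simp only [Function.update_apply]
        split_ifs <;> simp_all
    rw [hs]
    refine (h1.seq (RunsIn.loop_inc (by simp) _)).mono ?_ ?_
    · simp [cost]; omega
    · have := hb w le_rfl
      simp only [pairState_set_inl, pairState_set_inr, pairState_inl, pairState_inr]
      congr 1
      · simp
      · funext j
        have : w ≠ x := by omega
        simp only [Function.update_apply, eval]
        split_ifs <;> simp_all
  | const c =>
    intro x w a b o hx hb
    exact runsIn_addConst x c a b o
  | add e f ihe ihf =>
    intro x w a b o hx hb
    refine ((ihe x w a b o hx hb).seq (ihf x w a _ o hx fun j hj => ?_)).mono le_rfl ?_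
    · rw [Function.update_of_ne (by omega), hb j hj]
    · simp [eval, add_assoc]
  | mul e f ihe ihf =>
    intro x w a b o hx hb
    have h1 := ihe w (w + 1) a b o (by omega) fun j hj => hb j (by omega)
    have h2 := RunsIn.loop (i := .inr w) (P := f.comp x (w + 1)) (e.eval a)
      (fun k => pairState a (Function.update (Function.update b x (b x + k * f.eval a)) w
        (e.eval a - k)) o) (fun _ => f.cost a)
      (fun k _ => by simp) (fun k hk => by
        rw [pairState_set_inr]
        refine (ihf x (w + 1) a _ o (by omega) fun j hj => ?_).mono le_rfl ?_
        · have h1 : j ≠ w := by omega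
          have h2 : j ≠ x := by omega
          simp [h1, h2, hb j (by omega)]
        · congr 1
          funext j
          have : x ≠ w := by omega
          simp only [Function.update_apply]
          split_ifs <;> simp_all [add_mul] <;> omega)
    have hs : pairState a (Function.update b w (b w + e.eval a)) o = pairState a
        (Function.update (Function.update b x (b x + 0 * f.eval a)) w (e.eval a - 0)) o := by
      have := hb w le_rfl
      simp [this]
    rw [hs] at h1
    refine (h1.seq h2).mono ?_ ?_
    · simp [cost]
    · congr 1
      funext j
      have := hb w le_rfl
      simp only [Function.update_apply, eval]
      split_ifs <;> simp_all
  | sub e f ihe ihf =>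
    intro x w a b o hx hb
    have hbw := hb w le_rfl
    have hbw1 := hb (w + 1) (by omega)
    have h1 := ihe w (w + 1) a b o (by omega) fun j hj => hb j (by omega)
    have h2 := ihf (w + 1) (w + 2) a (Function.update b w (b w + e.eval a)) o (by omega)
      fun j hj => by rw [Function.update_of_ne (by omega), hb j (by omega)]
    have h3 := RunsIn.loop (i := .inr (w + 1)) (P := .dec (.inr w)) (f.eval a)
      (fun k => pairState a (Function.update (Function.update b w (e.eval a - k)) (w + 1)
        (f.eval a - k)) o) (fun _ => 1)
      (fun k _ => by simp) (fun k hk => by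
        rw [pairState_set_inr]
        refine (runsIn_dec_inr _ _ _ w).mono le_rfl ?_
        congr 1
        funext j
        simp only [Function.update_apply]
        split_ifs <;> omega)
    have hs : pairState a (Function.update (Function.update b w (b w + e.eval a)) (w + 1)
        (Function.update b w (b w + e.eval a) (w + 1) + f.eval a)) o = pairState a
        (Function.update (Function.update b w (e.eval a - 0)) (w + 1) (f.eval a - 0)) o := by
      simp [hbw, hbw1]
    rw [hs] at h2
    refine (h1.seq (h2.seq (h3.seq (RunsIn.loop_inc (by simp; omega) _)))).mono ?_ ?_
    · simp [cost]; omega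
    · simp only [pairState_set_inr, pairState_inr]
      congr 1
      funext j
      simp only [Function.update_apply, eval]
      split_ifs <;> first | omega | (subst_vars; omega)
  | sum v e f ihe ihf =>
    intro x w a b o hx hb
    have hbw := hb w le_rfl
    have hbw1 := hb (w + 1) (by omega)
    have h1 := ihe w (w + 2) a b o (by omega) fun j hj => hb j (by omega)
    have h2 := RunsIn.loop_inc (i := .inl v) (j := .inr (w + 1)) (by simp)
      (pairState a (Function.update b w (b w + e.eval a)) o)
    let S : ℕ → ℕ := fun k => ∑ i ∈ Finset.range k, f.eval (Function.update a v i)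
    have h3 := RunsIn.loop (i := .inr w) (P := .seq (f.comp x (w + 2)) (.inc (.inl v))) (e.eval a)
      (fun k => pairState (Function.update a v k) (Function.update (Function.update
        (Function.update b x (b x + S k)) (w + 1) (a v)) w (e.eval a - k)) o)
      (fun i => f.cost (Function.update a v i) + 1)
      (fun k _ => by simp) (fun k hk => by
        rw [pairState_set_inr]
        refine ((ihf x (w + 2) _ _ o (by omega) fun j hj => ?_).seq
          (runsIn_inc_inl _ _ _ v)).mono le_rfl ?_
        · have h1 : j ≠ w := by omega
          have h2 : j ≠ x := by omega
          have h3 : j ≠ w + 1 := by omega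
          simp [h1, h2, h3, hb j (by omega)]
        · congr 1
          · simp
          · funext j
            have h1 : x ≠ w := by omega
            have h2 : x ≠ w + 1 := by omega
            simp only [Function.update_apply, S, Finset.sum_range_succ]
            split_ifs <;> simp_all [add_assoc])
    have hs : ((pairState a (Function.update b w (b w + e.eval a)) o).set (.inl v) 0).set
        (.inr (w + 1)) ((pairState a (Function.update b w (b w + e.eval a)) o).ctr (.inr (w + 1)) +
        (pairState a (Function.update b w (b w + e.eval a)) o).ctr (.inl v)) =
        pairState (Function.update a v 0) (Function.update (Function.update
        (Function.update b x (b x + S 0)) (w + 1) (a v)) w (e.eval a - 0)) o := by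
      simp only [pairState_set_inr, pairState_set_inl, pairState_inr, pairState_inl]
      congr 1
      funext j
      simp only [Function.update_apply, S]
      split_ifs <;> simp_all
    rw [hs] at h2
    refine (h1.seq (h2.seq (h3.seq ((RunsIn.loop_skip _ _).seq
      (RunsIn.loop_inc (by simp) _))))).mono ?_ ?_
    · simp [cost]
    · simp only [pairState_set_inr, pairState_set_inl, pairState_inr, pairState_inl]
      congr 1
      · simp
      · funext j
        simp only [Function.update_apply, eval, S]
        split_ifs <;> simp_all

end Expr

theorem update_le {a : ℕ → ℕ} {B B' : ℕ} (ha : ∀ v, a v ≤ B) (hB : B ≤ B') {v i : ℕ}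
    (hi : i ≤ B') (w : ℕ) : Function.update a v i w ≤ B' := by
  rw [Function.update_apply]
  split
  · exact hi
  · exact (ha w).trans hB

/-- Values and costs must be bounded together, since the value of a factor or of a range is a number
of iterations. -/
theorem Expr.exists_polynomial (e : Expr) : ∃ p : Polynomial ℕ, ∀ (a : ℕ → ℕ) (B : ℕ),
    (∀ v, a v ≤ B) → e.eval a ≤ p.eval B ∧ e.cost a ≤ p.eval B := by
  induction e with
  | var v =>
    refine ⟨5 * Polynomial.X + 2, fun a B h => ?_⟩
    have := h v
    simp [eval, cost]
    omega
  | const c => exact ⟨Polynomial.C (c + 1), fun a B h => by simp [eval, cost]⟩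
  | add e f ihe ihf =>
    obtain ⟨p, hp⟩ := ihe
    obtain ⟨q, hq⟩ := ihf
    refine ⟨p + q, fun a B h => ?_⟩
    have h1 := hp a B h
    have h2 := hq a B h
    simp [eval, cost]
    omega
  | mul e f ihe ihf =>
    obtain ⟨p, hp⟩ := ihe
    obtain ⟨q, hq⟩ := ihf
    refine ⟨p + (p * (q + 1) + 1), fun a B h => ?_⟩
    have h1 := hp a B h
    have h2 := hq a B h
    have h3 := Nat.mul_le_mul h1.1 h2.1
    have h4 := Nat.mul_le_mul h1.1 (Nat.add_le_add_right h2.2 1)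
    simp [eval, cost]
    constructor
    · rw [mul_add]
      omega
    · omega
  | sub e f ihe ihf =>
    obtain ⟨p, hp⟩ := ihe
    obtain ⟨q, hq⟩ := ihf
    refine ⟨p + (q + (2 * q + 1 + (2 * p + 1))), fun a B h => ?_⟩
    have h1 := hp a B h
    have h2 := hq a B h
    simp [eval, cost]
    omega
  | sum v e f ihe ihf =>
    obtain ⟨p, hp⟩ := ihe
    obtain ⟨q, hq⟩ := ihf
    -- Inside the sum the index can be as large as the range, so the variables are bounded only by
    -- `B + p(B)`.
    let q' := q.comp (Polynomial.X + p)
    refine ⟨p + (2 * Polynomial.X + 1 + (p * (q' + 1 + 1) + 1 +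
      (2 * p + 1 + (2 * Polynomial.X + 1)))), fun a B h => ?_⟩
    have h1 := hp a B h
    have h2 : ∀ i ∈ Finset.range (e.eval a), f.eval (Function.update a v i) ≤ q'.eval B ∧
        f.cost (Function.update a v i) ≤ q'.eval B := by
      intro i hi
      have hi' := Finset.mem_range.1 hi
      have := hq (Function.update a v i) (B + p.eval B) fun w =>
        update_le h (by omega) (by omega) w
      simpa [q'] using this
    have h3 : ∑ i ∈ Finset.range (e.eval a), f.eval (Function.update a v i)
        ≤ e.eval a * q'.eval B := by
      simpa using Finset.sum_le_card_nsmul _ _ _ fun i hi => (h2 i hi).1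
    have h4 : ∑ i ∈ Finset.range (e.eval a), (f.cost (Function.update a v i) + 1 + 1)
        ≤ e.eval a * (q'.eval B + 1 + 1) := by
      simpa only [Finset.card_range, smul_eq_mul] using
        Finset.sum_le_card_nsmul (Finset.range (e.eval a))
          (fun i => f.cost (Function.update a v i) + 1 + 1) (q'.eval B + 1 + 1)
          fun i hi => by have := (h2 i hi).2; omega
    have h5 := Nat.mul_le_mul_right (q'.eval B) h1.1
    have h6 := Nat.mul_le_mul_right (q'.eval B + 1 + 1) h1.1
    have h7 := h v
    simp only [eval, cost, Polynomial.eval_add, Polynomial.eval_mul, Polynomial.eval_one,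
      Polynomial.eval_ofNat, Polynomial.eval_X]
    constructor
    · rw [mul_add, mul_add]
      omega
    · omega

/-! ### Programs with expressions -/

/-- Programs over named variables with assignments, output, and loops whose number of iterations
is the value of an expression. -/
inductive Prog : Type
  | assign (v : ℕ) (e : Expr) : Prog
  | emit (g : Γ') : Prog
  | seq (P Q : Prog) : Prog
  | rep (e : Expr) (P : Prog) : Prog

namespace Prog

/-- The effect of a program. -/
def run : Prog → State ℕ → State ℕ
  | assign v e, s => s.set v (e.eval s.ctr)
  | emit g, s => ⟨s.ctr, g :: s.out⟩
  | seq P Q, s => Q.run (P.run s)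
  | rep e P, s => P.run^[e.eval s.ctr] s

/-- A time bound for a program. -/
def cost : Prog → State ℕ → ℕ
  | assign v e, s => e.cost s.ctr + (2 * s.ctr v + 1 + (2 * e.eval s.ctr + 1))
  | emit _, _ => 1
  | seq P Q, s => P.cost s + Q.cost (P.run s)
  | rep e P, s =>
    e.cost s.ctr + (∑ k ∈ Finset.range (e.eval s.ctr), (P.cost (P.run^[k] s) + 1) + 1)

/-- `Bdd B P s` says that all values that `P` assigns when it is started in `s` are at most `B`. -/
def Bdd (B : ℕ) : Prog → State ℕ → Prop
  | assign _ e, s => e.eval s.ctr ≤ B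
  | emit _, _ => True
  | seq P Q, s => P.Bdd B s ∧ Q.Bdd B (P.run s)
  | rep e P, s => ∀ k < e.eval s.ctr, P.Bdd B (P.run^[k] s)

open Cmd in
/-- The counter program for a program, with auxiliary counters from `w` on. -/
def comp : Prog → ℕ → Cmd (ℕ ⊕ ℕ)
  | assign v e, w =>
    .seq (e.comp w (w + 1)) (.seq (loop (.inl v) skip) (loop (.inr w) (inc (.inl v))))
  | emit g, _ => .emit g
  | seq P Q, w => .seq (P.comp w) (Q.comp w)
  | rep e P, w => .seq (e.comp w (w + 1)) (loop (.inr w) (P.comp (w + 1)))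

/-- The auxiliary counters below `w` hold the remaining iterations of the enclosing loops, which is
why `b` is arbitrary there and has to be preserved. -/
theorem runsIn_comp (P : Prog) : ∀ (w : ℕ) (b : ℕ → ℕ) (s : State ℕ), (∀ j, w ≤ j → b j = 0) →
    RunsIn (P.comp w) (pairState s.ctr b s.out) (P.cost s)
      (pairState (P.run s).ctr b (P.run s).out) := by
  induction P with
  | assign v e =>
    intro w b s hb
    have hbw := hb w le_rfl
    have h1 := e.runsIn_comp w (w + 1) s.ctr b s.out (by omega) fun j hj => hb j (by omega)
    refine (h1.seq ((RunsIn.loop_skip _ _).seq (RunsIn.loop_inc (by simp) _))).mono ?_ ?_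
    · simp [cost, hbw]
    · simp only [pairState_set_inr, pairState_set_inl, pairState_inr, pairState_inl]
      have : Function.update b w 0 = b := by rw [← hbw]; simp
      simp [hbw, run, this]
  | emit g =>
    intro w b s hb
    exact ⟨1, le_rfl, (Cmd.Runs.emit _ _).of_eq rfl rfl⟩
  | seq P Q ihP ihQ =>
    intro w b s hb
    exact (ihP w b s hb).seq (ihQ w b _ hb)
  | rep e P ihP =>
    intro w b s hb
    have hbw := hb w le_rfl
    have hbu : Function.update b w 0 = b := by rw [← hbw]; simp
    have h1 := e.runsIn_comp w (w + 1) s.ctr b s.out (by omega) fun j hj => hb j (by omega)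
    have h2 := RunsIn.loop (i := .inr w) (P := P.comp (w + 1)) (e.eval s.ctr)
      (fun k => pairState (P.run^[k] s).ctr (Function.update b w (e.eval s.ctr - k))
        (P.run^[k] s).out) (fun k => P.cost (P.run^[k] s))
      (fun k _ => by simp) (fun k hk => by
        rw [pairState_set_inr, Function.update_idem]
        refine (ihP (w + 1) _ _ fun j hj => ?_).mono le_rfl ?_
        · rw [Function.update_of_ne (by omega), hb j (by omega)]
        · simp only [Function.iterate_succ', Function.comp_apply])
    have hs : pairState s.ctr (Function.update b w (b w + e.eval s.ctr)) s.out =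
        pairState (P.run^[0] s).ctr (Function.update b w (e.eval s.ctr - 0)) (P.run^[0] s).out := by
      simp [hbw]
    rw [hs] at h1
    exact (h1.seq h2).mono le_rfl (by simp [hbu, run])

theorem ctr_run_le {P : Prog} {B : ℕ} : ∀ {s : State ℕ}, (∀ v, s.ctr v ≤ B) → P.Bdd B s →
    ∀ v, (P.run s).ctr v ≤ B := by
  induction P with
  | assign v e => exact fun hs h w => update_le hs le_rfl h w
  | emit g => exact fun hs _ => hs
  | seq P Q ihP ihQ => exact fun hs h => ihQ (ihP hs h.1) h.2
  | rep e P ihP =>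
    intro s hs h
    have : ∀ k ≤ e.eval s.ctr, ∀ v, (P.run^[k] s).ctr v ≤ B := by
      intro k
      induction k with
      | zero => exact fun _ => hs
      | succ k ih =>
        intro hk
        rw [Function.iterate_succ_apply']
        exact ihP (ih (by omega)) (h k (by omega))
    exact this _ le_rfl

/-- Repeated assignments can make values grow exponentially, so the cost is polynomial only in a
bound for all values that arise; hence the hypothesis `Bdd`. -/
theorem exists_polynomial (P : Prog) : ∃ p : Polynomial ℕ, ∀ (s : State ℕ) (B : ℕ),
    (∀ v, s.ctr v ≤ B) → P.Bdd B s → P.cost s ≤ p.eval B := by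
  induction P with
  | assign v e =>
    obtain ⟨p, hp⟩ := e.exists_polynomial
    refine ⟨p + (2 * Polynomial.X + 1 + (2 * p + 1)), fun s B hs h => ?_⟩
    have h1 := hp _ _ hs
    have h2 := hs v
    simp [cost]
    omega
  | emit g => exact ⟨1, fun s B hs h => by simp [cost]⟩
  | seq P Q ihP ihQ =>
    obtain ⟨p, hp⟩ := ihP
    obtain ⟨q, hq⟩ := ihQ
    refine ⟨p + q, fun s B hs h => ?_⟩
    have h1 := hp s B hs h.1
    have h2 := hq _ B (ctr_run_le hs h.1) h.2
    simp [cost]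
    omega
  | rep e P ihP =>
    obtain ⟨p, hp⟩ := e.exists_polynomial
    obtain ⟨q, hq⟩ := ihP
    refine ⟨p + (p * (q + 1) + 1), fun s B hs h => ?_⟩
    have h1 := hp _ _ hs
    have h2 : ∀ k ∈ Finset.range (e.eval s.ctr), P.cost (P.run^[k] s) + 1 ≤ q.eval B + 1 := by
      intro k hk
      have hk' := Finset.mem_range.1 hk
      have h3 : ∀ v, (P.run^[k] s).ctr v ≤ B := by
        -- The state after `k` rounds is the final state of the loop cut off after `k` rounds.
        have := ctr_run_le (P := rep (.const k) P) (s := s) (B := B) hs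
          fun l hl => h l (lt_trans hl hk')
        exact this
      exact Nat.add_le_add_right (hq _ _ h3 (h k hk')) 1
    have h4 := Finset.sum_le_card_nsmul _ _ _ h2
    rw [Finset.card_range, smul_eq_mul] at h4
    have h5 := Nat.mul_le_mul_right (q.eval B + 1) h1.1
    simp only [cost, Polynomial.eval_add, Polynomial.eval_mul, Polynomial.eval_one]
    omega

/-- A function of a natural number in unary is computable in polynomial time if a program emits its
values and the values of the variables are bounded by a polynomial. -/
theorem computableInPolyTime {β : Type} {f : ℕ → β} {eb : β → List Γ'} (P : Prog)
    (p : Polynomial ℕ)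
    (hB : ∀ n, P.Bdd (p.eval n) ⟨Function.update (fun _ => 0) 0 n, []⟩)
    (hf : ∀ n, (P.run ⟨Function.update (fun _ => 0) 0 n, []⟩).out.reverse = eb (f n)) :
    Nonempty (Turing.TM2ComputableInPolyTime unaryEncodeNat eb f) := by
  obtain ⟨q, hq⟩ := P.exists_polynomial
  -- The summand `X` covers the input value, which `Bdd` does not control.
  refine Cmd.computableInPolyTime_of_runs (P.comp 0) (.inl 0) (q.comp (p + Polynomial.X))
    fun n => ?_
  have hB' : ∀ {B B' : ℕ} (Q : Prog) (s : State ℕ), B ≤ B' → Q.Bdd B s → Q.Bdd B' s := by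
    intro B B' Q s hBB
    induction Q generalizing s with
    | assign v e => exact fun h => h.trans hBB
    | emit g => exact fun h => h
    | seq P Q ihP ihQ => exact fun h => ⟨ihP _ h.1, ihQ _ h.2⟩
    | rep e P ihP => exact fun h k hk => ihP _ (h k hk)
  obtain ⟨t, ht, hr⟩ := P.runsIn_comp 0 (fun _ => 0) ⟨Function.update (fun _ => 0) 0 n, []⟩
    fun _ _ => rfl
  refine ⟨t, ht.trans ?_, pairState (P.run ⟨Function.update (fun _ => 0) 0 n, []⟩).ctr (fun _ => 0)
    (P.run ⟨Function.update (fun _ => 0) 0 n, []⟩).out, ?_, hf n⟩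
  · rw [Polynomial.eval_comp]
    refine hq _ _ (fun v => ?_) (hB' _ _ ?_ (hB n))
    · change Function.update (fun _ => 0) 0 n v ≤ _
      rw [Function.update_apply]
      split <;> simp
    · simp
  · convert hr using 1
    ext j
    · rcases j with j | j <;> simp [Cmd.initState, pairState, Function.update_apply]
    · rfl

end Prog
end CounterProgram

/-! ### A polynomial bound for the primes congruent to 1 modulo 4 -/

section PrimeBound

open Finset ArithmeticFunction

/-- Write log as the divisor sum of Λ and exchange the two summations. -/
theorem sum_log_eq_sum_vonMangoldt (A : Finset ℕ) (g : ℕ → ℕ) (Y : ℕ)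
    (hg : ∀ k ∈ A, 0 < g k ∧ g k ≤ Y) :
    ∑ k ∈ A, Real.log (g k) = ∑ d ∈ Ioc 0 Y, vonMangoldt d * #{k ∈ A | d ∣ g k} := by
  have h1 : ∀ k ∈ A, Real.log (g k) = ∑ d ∈ (g k).divisors, vonMangoldt d :=
    fun k _ => vonMangoldt_sum.symm
  rw [sum_congr rfl h1, sum_comm' (t' := Ioc 0 Y) (s' := fun d => {k ∈ A | d ∣ g k})]
  · refine sum_congr rfl fun d _ => ?_
    rw [sum_const, nsmul_eq_mul, mul_comm]
  · intro k d
    simp only [Nat.mem_divisors, mem_filter, mem_Ioc]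
    constructor
    · rintro ⟨hk, hd, h0⟩
      exact ⟨⟨hk, hd⟩, Nat.pos_of_dvd_of_pos hd (hg k hk).1,
        (Nat.le_of_dvd (hg k hk).1 hd).trans (hg k hk).2⟩
    · rintro ⟨⟨hk, hd⟩, -⟩
      exact ⟨hk, hd, (hg k hk).1.ne'⟩

/-- A weak Mertens estimate: log x! = ∑ Λ(d)⌊x/d⌋ is at most x log x, and ⌊x/d⌋ ≥ x/(2d) for d ≤ x.
-/
theorem sum_vonMangoldt_div_le (x : ℕ) :
    ∑ d ∈ Ioc 0 x, vonMangoldt d / d ≤ 2 * Real.log x := by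
  rcases Nat.eq_zero_or_pos x with rfl | hx
  · simp
  have h1 := sum_log_eq_sum_vonMangoldt (Ioc 0 x) id x fun k hk => mem_Ioc.1 hk
  have h2 : ∑ k ∈ Ioc 0 x, Real.log (id k : ℕ) ≤ x * Real.log x := by
    have := sum_le_card_nsmul (Ioc 0 x) (fun k : ℕ => Real.log (id k : ℕ)) (Real.log x)
      fun k hk => by
        have := mem_Ioc.1 hk
        exact Real.log_le_log (by exact_mod_cast this.1) (by exact_mod_cast this.2)
    simpa using this
  have h3 : (x / 2 : ℝ) * ∑ d ∈ Ioc 0 x, vonMangoldt d / d ≤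
      ∑ d ∈ Ioc 0 x, vonMangoldt d * #{k ∈ Ioc 0 x | d ∣ id k} := by
    rw [mul_sum]
    refine sum_le_sum fun d hd => ?_
    obtain ⟨hd0, hdx⟩ := mem_Ioc.1 hd
    have hc : #{k ∈ Ioc 0 x | d ∣ id k} = x / d := Nat.Ioc_filter_dvd_card_eq_div x d
    rw [hc]
    have h4 : (x : ℝ) ≤ 2 * ((x / d : ℕ) : ℝ) * d := by
      have h5 := Nat.div_add_mod x d
      have h6 := Nat.mod_lt x hd0
      have h7 : 1 ≤ x / d := (Nat.one_le_div_iff hd0).2 hdx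
      have : x ≤ 2 * (x / d) * d := by nlinarith
      exact_mod_cast this
    have hd' : (0 : ℝ) < d := by exact_mod_cast hd0
    calc (x / 2 : ℝ) * (vonMangoldt d / d) = vonMangoldt d * (x / (2 * d)) := by ring
      _ ≤ vonMangoldt d * ((x / d : ℕ) : ℝ) := by
        refine mul_le_mul_of_nonneg_left ?_ vonMangoldt_nonneg
        rw [div_le_iff₀ (by positivity)]
        linarith
  rw [h1] at h2
  have hx' : (0 : ℝ) < x := by exact_mod_cast hx
  have := h3.trans h2
  nlinarith

theorem card_filter_modEq_le (N v : ℕ) {d : ℕ} (hd : 0 < d) :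
    (#{k ∈ Ioc 0 N | k ≡ v [MOD d]} : ℝ) ≤ N / d + 1 := by
  have h := Nat.Ioc_filter_modEq_card 0 N hd v
  have hd' : (0 : ℚ) < d := by exact_mod_cast hd
  have h1 : (#{k ∈ Ioc 0 N | k ≡ v [MOD d]} : ℤ) < (N / d : ℚ) + 1 ∨
      (#{k ∈ Ioc 0 N | k ≡ v [MOD d]} : ℤ) = 0 := by
    rcases max_choice (⌊((N : ℚ) - v) / d⌋ - ⌊((0 : ℕ) - v : ℚ) / d⌋) 0 with h2 | h2
    · left
      rw [h, h2]
      have h3 := Int.floor_le (((N : ℚ) - v) / d)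
      have h4 := Int.lt_floor_add_one ((((0 : ℕ) : ℚ) - v) / d)
      have h5 : ((N : ℚ) - v) / d = N / d + (((0 : ℕ) : ℚ) - v) / d := by
        push_cast; ring
      push_cast at *
      linarith
    · right; rw [h, h2]
  rcases h1 with h1 | h1
  · have : ((#{k ∈ Ioc 0 N | k ≡ v [MOD d]} : ℚ) : ℝ) ≤ ((N / d + 1 : ℚ) : ℝ) := by
      exact_mod_cast h1.le
    simpa using this
  · have : #{k ∈ Ioc 0 N | k ≡ v [MOD d]} = 0 := by exact_mod_cast h1
    rw [this, Nat.cast_zero]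
    positivity

/-- The difference of the two values is 4(k - l)(k + l). For a > 0, p divides neither 4 nor 2k, so
it cannot divide both k - l and k + l, and the whole power falls on one of them. -/
theorem dvd_sub_or_dvd_add {p a : ℕ} (hp : p.Prime) {k l : ℕ} (hk : p ^ a ∣ 4 * k ^ 2 + 1)
    (hl : p ^ a ∣ 4 * l ^ 2 + 1) : (p ^ a : ℤ) ∣ k - l ∨ (p ^ a : ℤ) ∣ k + l := by
  rcases Nat.eq_zero_or_pos a with rfl | ha
  · simp
  have hpk : (p : ℤ) ∣ 4 * k ^ 2 + 1 := by
    exact_mod_cast (dvd_pow_self p ha.ne').trans hk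
  have hp' : Prime (p : ℤ) := Nat.prime_iff_prime_int.1 hp
  have h2k : ¬ (p : ℤ) ∣ 2 * k := fun h => by
    have h1 : (p : ℤ) ∣ 1 := by
      have h2 := (dvd_sub hpk (h.mul_right (2 * k)))
      have h3 : (4 * (k : ℤ) ^ 2 + 1 - 2 * k * (2 * k)) = 1 := by ring
      rwa [h3] at h2
    exact hp'.not_isUnit (isUnit_of_dvd_one h1)
  have h4 : ¬ (p : ℤ) ∣ 4 := fun h => by
    have h1 : (p : ℤ) ∣ 2 := by
      have : (4 : ℤ) = 2 * 2 := by norm_num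
      rw [this] at h
      exact (hp'.dvd_or_dvd h).elim id id
    exact h2k (h1.mul_right _)
  have hmul : (p ^ a : ℤ) ∣ 4 * ((k - l) * (k + l)) := by
    have h1 : (p ^ a : ℤ) ∣ 4 * k ^ 2 + 1 := by exact_mod_cast hk
    have h2 : (p ^ a : ℤ) ∣ 4 * l ^ 2 + 1 := by exact_mod_cast hl
    have h3 := dvd_sub h1 h2
    have h5 : (4 * (k : ℤ) ^ 2 + 1 - (4 * l ^ 2 + 1)) = 4 * ((k - l) * (k + l)) := by ring
    rwa [h5] at h3
  have hmul' : (p ^ a : ℤ) ∣ (k - l) * (k + l) :=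
    ((hp'.coprime_iff_not_dvd.2 h4).pow_left).dvd_of_dvd_mul_left hmul
  by_cases h : (p : ℤ) ∣ k - l
  · left
    have h' : ¬ (p : ℤ) ∣ k + l := fun h' => h2k (by
      have := dvd_add h h'
      have e : ((k : ℤ) - l + (k + l)) = 2 * k := by ring
      rwa [e] at this)
    exact ((hp'.coprime_iff_not_dvd.2 h').pow_left).dvd_of_dvd_mul_right hmul'
  · right
    exact ((hp'.coprime_iff_not_dvd.2 h).pow_left).dvd_of_dvd_mul_left hmul'

theorem card_filter_dvd_le (N : ℕ) {d : ℕ} (hd : IsPrimePow d) :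
    (#{k ∈ Ioc 0 N | d ∣ 4 * k ^ 2 + 1} : ℝ) ≤ 2 * (N / d + 1) := by
  have hd0 : 0 < d := hd.pos
  by_cases h : ∃ l, d ∣ 4 * l ^ 2 + 1
  · obtain ⟨l, hl⟩ := h
    -- All solutions are congruent to ±l modulo d; `d * l - l` is a natural number representing -l.
    have hsub : {k ∈ Ioc 0 N | d ∣ 4 * k ^ 2 + 1} ⊆
        {k ∈ Ioc 0 N | k ≡ l [MOD d]} ∪ {k ∈ Ioc 0 N | k ≡ d * l - l [MOD d]} := by
      intro k hk
      simp only [mem_filter, mem_union] at hk ⊢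
      obtain ⟨p, a, hp, -, rfl⟩ := (isPrimePow_nat_iff d).1 hd
      rcases dvd_sub_or_dvd_add hp hk.2 hl with h | h
      · exact Or.inl ⟨hk.1, (Nat.modEq_iff_dvd.2 (by
          rw [← dvd_neg]; push_cast; simpa using h))⟩
      · refine Or.inr ⟨hk.1, Nat.modEq_iff_dvd.2 ?_⟩
        rw [Nat.cast_sub (Nat.le_mul_of_pos_left l hd0)]
        have e : (((p ^ a * l : ℕ) : ℤ) - l - k) = (p ^ a : ℤ) * l - (k + l) := by push_cast; ring
        rw [e]
        push_cast
        exact dvd_sub (dvd_mul_right _ _) h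
    have h1 : (#{k ∈ Ioc 0 N | d ∣ 4 * k ^ 2 + 1} : ℝ) ≤
        #{k ∈ Ioc 0 N | k ≡ l [MOD d]} + #{k ∈ Ioc 0 N | k ≡ d * l - l [MOD d]} := by
      exact_mod_cast (card_le_card hsub).trans (card_union_le _ _)
    have h2 := card_filter_modEq_le N l hd0
    have h3 := card_filter_modEq_le N (d * l - l) hd0
    linarith
  · have : {k ∈ Ioc 0 N | d ∣ 4 * k ^ 2 + 1} = ∅ :=
      filter_eq_empty_iff.2 fun k _ hk => h ⟨k, hk⟩
    rw [this]
    simp only [card_empty, Nat.cast_zero]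
    positivity

/-- Group the prime powers by their prime p = `minFac`. There are at most ⌊log_p Y⌋ powers of p,
each contributing log p, so each prime contributes at most log Y. -/
theorem sum_vonMangoldt_le (S D : Finset ℕ) (Y : ℕ) (hD : ∀ d ∈ D, d ≤ Y ∧ IsPrimePow d)
    (hS : ∀ d ∈ D, d.minFac ∈ S) :
    ∑ d ∈ D, vonMangoldt d ≤ #S * Real.log Y := by
  rw [← sum_fiberwise_of_maps_to hS, ← nsmul_eq_mul]
  refine sum_le_card_nsmul _ _ _ fun p _ => ?_
  rcases (D.filter fun d => d.minFac = p).eq_empty_or_nonempty with h | ⟨d0, hd0⟩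
  · rw [h, sum_empty]
    exact Real.log_natCast_nonneg Y
  obtain ⟨hd0D, hd0p⟩ := mem_filter.1 hd0
  have hp : p.Prime := hd0p ▸ Nat.minFac_prime (hD d0 hd0D).2.ne_one
  have hY : Y ≠ 0 := fun h => by
    have h1 := (hD d0 hd0D).1
    have h2 := (hD d0 hd0D).2.pos
    omega
  have h1 : ∀ d ∈ D.filter fun d => d.minFac = p, vonMangoldt d ≤ Real.log p := fun d hd => by
    obtain ⟨hdD, hdp⟩ := mem_filter.1 hd
    rw [vonMangoldt_apply, if_pos (hD d hdD).2, hdp]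
  have h2 : (D.filter fun d => d.minFac = p) ⊆ (Ioc 0 (Nat.log p Y)).image (p ^ ·) := by
    intro d hd
    obtain ⟨hdD, hdp⟩ := mem_filter.1 hd
    obtain ⟨q, a, hq, ha, rfl⟩ := (isPrimePow_nat_iff d).1 (hD d hdD).2
    rw [hq.pow_minFac ha.ne'] at hdp
    subst hdp
    exact mem_image.2 ⟨a, mem_Ioc.2 ⟨ha, Nat.le_log_of_pow_le hq.one_lt (hD _ hdD).1⟩, rfl⟩
  have h3 : #(D.filter fun d => d.minFac = p) ≤ Nat.log p Y := by
    simpa using (card_le_card h2).trans card_image_le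
  calc _ ≤ #(D.filter fun d => d.minFac = p) • Real.log p := sum_le_card_nsmul _ _ _ h1
    _ ≤ (Nat.log p Y : ℝ) * Real.log p := by
      rw [nsmul_eq_mul]
      exact mul_le_mul_of_nonneg_right (by exact_mod_cast h3) (Real.log_natCast_nonneg p)
    _ = Real.log ((p ^ Nat.log p Y : ℕ) : ℝ) := by push_cast; rw [Real.log_pow]
    _ ≤ Real.log Y := by
      refine Real.log_le_log ?_ ?_
      · exact_mod_cast Nat.pow_pos hp.pos
      · exact_mod_cast Nat.pow_log_le_self p hY

/-- Modulo this prime, -1 is the square of 2k, which excludes 3 modulo 4. Using 4k² + 1 instead of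
k² + 1 also excludes the prime 2. -/
theorem minFac_mod_four_of_dvd {d k : ℕ} (hd : d ≠ 1) (h : d ∣ 4 * k ^ 2 + 1) :
    d.minFac.Prime ∧ d.minFac % 4 = 1 := by
  have hp := Nat.minFac_prime hd
  have hdvd := (Nat.minFac_dvd d).trans h
  have := Fact.mk hp
  have h3 : d.minFac % 4 ≠ 3 := by
    refine ZMod.mod_four_ne_three_of_sq_eq_neg_one (y := ((2 * k : ℕ) : ZMod d.minFac)) ?_
    have := (ZMod.natCast_eq_zero_iff (4 * k ^ 2 + 1) d.minFac).2 hdvd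
    push_cast at this ⊢
    linear_combination this
  have h2 : ¬ 2 ∣ d.minFac := fun h2 => by
    have := h2.trans hdvd
    omega
  exact ⟨hp, by omega⟩

/-- Only prime powers in `D` contribute, each with multiplicity at most 2(N/d + 1). In ∑ Λ(d)/d the
terms with d ≤ x are bounded by the Mertens estimate, regardless of `s`; those with d > x are
bounded by Λ(d)/x, and there the scarcity of primes enters. -/
theorem sum_log_le (s N x Y : ℕ) (hx : 0 < x) (hY : Y = 4 * N ^ 2 + 1)
    (hs : #{p ∈ range (Y + 1) | p.Prime ∧ p % 4 = 1} ≤ s) :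
    ∑ k ∈ Ioc 0 N, Real.log ((4 * k ^ 2 + 1 : ℕ) : ℝ) ≤
      2 * N * (2 * Real.log x + s * Real.log Y / x) + 2 * (s * Real.log Y) := by
  have hY1 : ∀ k ∈ Ioc 0 N, 0 < 4 * k ^ 2 + 1 ∧ 4 * k ^ 2 + 1 ≤ Y := fun k hk => by
    have := Nat.pow_le_pow_left (mem_Ioc.1 hk).2 2
    omega
  set D : Finset ℕ := {d ∈ Ioc 0 Y | IsPrimePow d ∧ ∃ k ∈ Ioc 0 N, d ∣ 4 * k ^ 2 + 1} with hD
  have hDm : ∀ d ∈ D, 0 < d ∧ d ≤ Y ∧ IsPrimePow d ∧ ∃ k ∈ Ioc 0 N, d ∣ 4 * k ^ 2 + 1 :=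
    fun d hd => ⟨(mem_Ioc.1 (mem_filter.1 hd).1).1, (mem_Ioc.1 (mem_filter.1 hd).1).2,
      (mem_filter.1 hd).2⟩
  have hD1 : ∑ d ∈ D, vonMangoldt d ≤ s * Real.log Y := by
    refine (sum_vonMangoldt_le {p ∈ range (Y + 1) | p.Prime ∧ p % 4 = 1} D Y
      (fun d hd => ⟨(hDm d hd).2.1, (hDm d hd).2.2.1⟩) fun d hd => ?_).trans
      (mul_le_mul_of_nonneg_right (by exact_mod_cast hs) (Real.log_natCast_nonneg Y))
    obtain ⟨hd0, hdY, hpp, k, -, hk⟩ := hDm d hd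
    refine mem_filter.2 ⟨mem_range.2 ?_, minFac_mod_four_of_dvd hpp.ne_one hk⟩
    have := Nat.minFac_le hd0
    omega
  have hx' : (0 : ℝ) < x := by exact_mod_cast hx
  have hD2 : ∑ d ∈ D, vonMangoldt d / d ≤ 2 * Real.log x + s * Real.log Y / x := by
    have h1 : ∀ d ∈ D, vonMangoldt d / d ≤
        (if d ≤ x then vonMangoldt d / d else 0) + vonMangoldt d / x := by
      intro d hd
      have h0 : (0 : ℝ) < d := by exact_mod_cast (hDm d hd).1
      split_ifs with h
      · have : 0 ≤ vonMangoldt d / x := div_nonneg vonMangoldt_nonneg hx'.le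
        linarith
      · rw [zero_add]
        refine div_le_div_of_nonneg_left vonMangoldt_nonneg hx' ?_
        exact_mod_cast (not_le.1 h).le
    refine (sum_le_sum h1).trans ?_
    rw [sum_add_distrib, ← sum_filter, ← sum_div]
    refine add_le_add (le_trans (sum_le_sum_of_subset_of_nonneg ?_ ?_) (sum_vonMangoldt_div_le x))
      (div_le_div_of_nonneg_right hD1 hx'.le)
    · intro d hd
      obtain ⟨hd, hdx⟩ := mem_filter.1 hd
      exact mem_Ioc.2 ⟨(hDm d hd).1, hdx⟩
    · exact fun d _ _ => div_nonneg vonMangoldt_nonneg (Nat.cast_nonneg d)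
  have h1 : ∑ d ∈ Ioc 0 Y, vonMangoldt d * (#{k ∈ Ioc 0 N | d ∣ 4 * k ^ 2 + 1} : ℝ) =
      ∑ d ∈ D, vonMangoldt d * (#{k ∈ Ioc 0 N | d ∣ 4 * k ^ 2 + 1} : ℝ) := by
    refine (sum_filter_of_ne fun d _ h => ?_).symm
    constructor
    · exact vonMangoldt_ne_zero_iff.1 (left_ne_zero_of_mul h)
    · have h2 : #{k ∈ Ioc 0 N | d ∣ 4 * k ^ 2 + 1} ≠ 0 := by
        exact_mod_cast right_ne_zero_of_mul h
      obtain ⟨k, hk⟩ := card_ne_zero.1 h2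
      exact ⟨k, (mem_filter.1 hk).1, (mem_filter.1 hk).2⟩
  have h2 : ∑ d ∈ D, vonMangoldt d * (#{k ∈ Ioc 0 N | d ∣ 4 * k ^ 2 + 1} : ℝ) ≤
      ∑ d ∈ D, (2 * N * (vonMangoldt d / d) + 2 * vonMangoldt d) := by
    refine sum_le_sum fun d hd => ?_
    have := mul_le_mul_of_nonneg_left (card_filter_dvd_le N (hDm d hd).2.2.1)
      (vonMangoldt_nonneg (n := d))
    refine this.trans (le_of_eq ?_)
    ring
  rw [sum_log_eq_sum_vonMangoldt (Ioc 0 N) (fun k => 4 * k ^ 2 + 1) Y hY1, h1]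
  refine h2.trans ?_
  rw [sum_add_distrib, ← mul_sum, ← mul_sum]
  gcongr

theorem le_sum_log {N : ℕ} (hN : N ≠ 0) :
    2 * (N * Real.log N - N) ≤ ∑ k ∈ Ioc 0 N, Real.log ((4 * k ^ 2 + 1 : ℕ) : ℝ) := by
  have h1 := Stirling.le_log_factorial_stirling hN
  have h2 : 0 ≤ Real.log N := Real.log_natCast_nonneg N
  have h3 : 0 ≤ Real.log (2 * Real.pi) := Real.log_nonneg (by linarith [Real.pi_gt_three])
  have h4 : Real.log N.factorial = ∑ k ∈ Ioc 0 N, Real.log (k : ℝ) := by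
    clear h1 h2 hN
    induction N with
    | zero => simp
    | succ N ih =>
      rw [Nat.factorial_succ, Nat.cast_mul, Real.log_mul (by positivity) (by positivity), ih,
        sum_Ioc_succ_top N.zero_le, add_comm]
  have h5 : ∑ k ∈ Ioc 0 N, 2 * Real.log (k : ℝ) ≤
      ∑ k ∈ Ioc 0 N, Real.log ((4 * k ^ 2 + 1 : ℕ) : ℝ) := by
    refine sum_le_sum fun k hk => ?_
    have hk0 : (0 : ℝ) < k := by exact_mod_cast (mem_Ioc.1 hk).1
    have : 2 * Real.log (k : ℝ) = Real.log ((k : ℝ) ^ 2) := by rw [Real.log_pow]; norm_num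
    rw [this]
    refine Real.log_le_log (by positivity) ?_
    push_cast
    nlinarith
  rw [← mul_sum, ← h4] at h5
  linarith

/-- A lower bound for the number of primes congruent to `1` modulo `4`. -/
theorem lt_card_primes {M : ℕ} (hM : 100 ≤ M) :
    M < #{p ∈ range (4 * M ^ 12 + 2) | p.Prime ∧ p % 4 = 1} := by
  by_contra! hs
  have hY : 4 * M ^ 12 + 1 = 4 * (M ^ 6) ^ 2 + 1 := by ring
  -- With N = M⁶ and l = log M the lower bound is 12Nl - 2N. The choice x = M² makes the main term
  -- of the upper bound 8Nl, and for M ≥ 100 the two other terms are at most 0.26Nl each. Since l ≥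
  -- 2 gives 2N ≤ Nl, this is a contradiction.
  have h1 := sum_log_le M (M ^ 6) (M ^ 2) (4 * M ^ 12 + 1) (by positivity) hY hs
  have h2 := (le_sum_log (N := M ^ 6) (by positivity)).trans h1
  have hM' : (100 : ℝ) ≤ M := by exact_mod_cast hM
  set l := Real.log M with hl
  have hl2 : 2 ≤ l := by
    rw [hl, Real.le_log_iff_exp_le (by linarith)]
    have h3 := Real.exp_one_lt_d9
    have h4 : Real.exp 2 = Real.exp 1 * Real.exp 1 := by rw [← Real.exp_add]; norm_num
    rw [h4]
    have := Real.exp_pos 1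
    nlinarith
  have hL : Real.log ((4 * M ^ 12 + 1 : ℕ) : ℝ) ≤ 13 * l := by
    have : 13 * l = Real.log ((M : ℝ) ^ 13) := by rw [Real.log_pow, ← hl]; norm_num
    rw [this]
    refine Real.log_le_log (by positivity) ?_
    push_cast
    have : (1 : ℝ) ≤ (M : ℝ) ^ 12 := one_le_pow₀ (by linarith)
    have e : (M : ℝ) ^ 13 = M * M ^ 12 := by ring
    rw [e]
    nlinarith
  set L := Real.log ((4 * M ^ 12 + 1 : ℕ) : ℝ)
  have hM0 : (0 : ℝ) < M := by linarith
  have e1 : Real.log ((M ^ 6 : ℕ) : ℝ) = 6 * l := by push_cast; rw [Real.log_pow, ← hl]; norm_num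
  have e2 : Real.log ((M ^ 2 : ℕ) : ℝ) = 2 * l := by push_cast; rw [Real.log_pow, ← hl]; norm_num
  have e3 : (M : ℝ) * L / ((M ^ 2 : ℕ) : ℝ) = L / M := by push_cast; field_simp
  rw [e1, e2, e3] at h2
  have h5 : L / M ≤ 13 / 100 * l := by
    rw [div_le_iff₀ hM0]
    nlinarith
  push_cast at h2
  set N : ℝ := (M : ℝ) ^ 6 with hN
  have h6 : 100 * (M : ℝ) ≤ N := by
    have h7 : (100 : ℝ) ≤ (M : ℝ) ^ 5 := hM'.trans (le_self_pow₀ (by linarith) (by norm_num))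
    have e : N = M * M ^ 5 := by rw [hN]; ring
    rw [e]
    nlinarith
  have hN0 : 0 ≤ N := by positivity
  have h8 : N * (L / M) ≤ N * (13 / 100 * l) := mul_le_mul_of_nonneg_left h5 hN0
  have h9 : (M : ℝ) * L ≤ N / 100 * (13 * l) :=
    mul_le_mul (by linarith) hL (Real.log_natCast_nonneg _) (by positivity)
  have h10 : 2 * N ≤ N * l := by nlinarith
  have h11 : 0 < N * l := by positivity
  nlinarith

theorem infinite_primes_one_mod_four : {p : ℕ | p.Prime ∧ p % 4 = 1}.Infinite := by
  refine Set.infinite_of_not_bddAbove fun ⟨B, hB⟩ => ?_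
  obtain ⟨p, hp, hBp, hm⟩ := Nat.exists_prime_gt_modEq_one (k := 4) B (by norm_num)
  have : p ≤ B := hB ⟨hp, hm⟩
  omega

theorem primeOneModFour_lt (j : ℕ) : primeOneModFour j < 4 * (j + 100) ^ 12 + 2 := by
  refine Nat.nth_lt_of_lt_count ?_
  rw [Nat.count_eq_card_filter_range]
  have := lt_card_primes (M := j + 100) (by omega)
  omega

theorem primeOneModFour_spec (j : ℕ) : (primeOneModFour j).Prime ∧ primeOneModFour j % 4 = 1 :=
  Nat.nth_mem_of_infinite infinite_primes_one_mod_four j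

theorem primeOneModFour_injective : Function.Injective primeOneModFour :=
  Nat.nth_injective infinite_primes_one_mod_four

end PrimeBound

/-! ### Gaussian integers and multiplicative independence -/

section GaussianPoints

open GaussianInt

/-- If `p` divides the norm of `a + b i` but not `a`, there is a ring homomorphism from the Gaussian
integers to `ℤ/p` that maps `a + b i` to zero. -/
theorem exists_ringHom_zmod {p : ℕ} [Fact p.Prime] {a b : ℤ} (h : ((a ^ 2 + b ^ 2 : ℤ) : ZMod p) = 0)
    (ha : (a : ZMod p) ≠ 0) :
    ∃ φ : GaussianInt →+* ZMod p, φ ⟨a, b⟩ = 0 ∧ φ ⟨a, -b⟩ = 2 * a := by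
  push_cast at h
  have hb : (b : ZMod p) ≠ 0 := fun hb => ha (by simpa [hb] using h)
  -- The homomorphism sends i to -a/b, a square root of -1 because a² = -b² in ℤ/p.
  have hr : (-(a : ZMod p) / b) * (-(a : ZMod p) / b) = ((-1 : ℤ) : ZMod p) := by
    field_simp
    push_cast
    linear_combination h
  refine ⟨Zsqrtd.lift ⟨_, hr⟩, ?_, ?_⟩
  · simp only [Zsqrtd.lift_apply_apply]
    field_simp
    ring
  · simp only [Zsqrtd.lift_apply_apply]
    push_cast
    field_simp
    ring

variable {ι : Type*} [Fintype ι]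

/-- Apply the homomorphism to ℤ/p_j that kills a_j + b_j i. The left side vanishes because `u j ≠
0`. On the right, the factor at j is a power of 2a_j ≠ 0 because `v j = 0`, and the factors at k ≠ j
divide powers of p_k, which is invertible modulo p_j. -/
theorem prod_gaussian_ne {p : ι → ℕ} (hp : ∀ k, (p k).Prime ∧ p k % 4 = 1)
    (hinj : Function.Injective p) {a b : ι → ℤ} (ha : ∀ k, 0 < a k)
    (hab : ∀ k, a k ^ 2 + b k ^ 2 = p k) {u v : ι → ℕ} {j : ι} (hu : u j ≠ 0) (hv : v j = 0) :
    ∏ k, ((⟨a k, b k⟩ : GaussianInt) ^ u k * (⟨a k, -b k⟩ : GaussianInt) ^ v k) ≠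
      ∏ k, ((⟨a k, -b k⟩ : GaussianInt) ^ u k * (⟨a k, b k⟩ : GaussianInt) ^ v k) := by
  intro h
  have : Fact (p j).Prime := ⟨(hp j).1⟩
  have hj2 : (p j : ℤ) % 4 = 1 := by exact_mod_cast (hp j).2
  have hpj : (2 : ℤ) ≤ p j := by exact_mod_cast (hp j).1.two_le
  have haj : (a j : ZMod (p j)) ≠ 0 := by
    rw [Ne, ZMod.intCast_zmod_eq_zero_iff_dvd]
    intro hd
    have h1 := Int.le_of_dvd (ha j) hd
    have h2 := hab j
    nlinarith [sq_nonneg (b j)]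
  have h2 : (2 : ZMod (p j)) ≠ 0 := by
    have : ((2 : ℤ) : ZMod (p j)) ≠ 0 := by
      rw [Ne, ZMod.intCast_zmod_eq_zero_iff_dvd]
      intro hd
      have := Int.le_of_dvd (by norm_num) hd
      omega
    exact_mod_cast this
  obtain ⟨φ, h0, h1⟩ := exists_ringHom_zmod (p := p j) (a := a j) (b := b j)
    (by rw [hab j]; simp) haj
  have hk : ∀ k, k ≠ j → φ ⟨a k, b k⟩ ≠ 0 ∧ φ ⟨a k, -b k⟩ ≠ 0 := by
    intro k hkj
    have hm : φ ⟨a k, b k⟩ * φ ⟨a k, -b k⟩ = (p k : ZMod (p j)) := by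
      rw [← map_mul]
      have : (⟨a k, b k⟩ * ⟨a k, -b k⟩ : GaussianInt) = ((p k : ℤ) : GaussianInt) := by
        rw [← hab k]
        ext <;> simp [pow_two] <;> ring
      rw [this]
      simp
    have hpk : (p k : ZMod (p j)) ≠ 0 := by
      rw [Ne, ZMod.natCast_eq_zero_iff, Nat.prime_dvd_prime_iff_eq (hp j).1 (hp k).1]
      exact fun e => hkj (hinj e.symm)
    rw [← hm] at hpk
    exact ⟨left_ne_zero_of_mul hpk, right_ne_zero_of_mul hpk⟩
  have hφ := congrArg φ h
  simp only [map_prod, map_mul, map_pow] at hφ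
  rw [Finset.prod_eq_zero (Finset.mem_univ j) (by rw [h0, zero_pow hu, zero_mul])] at hφ
  refine (Finset.prod_ne_zero_iff.2 fun k _ => ?_) hφ.symm
  by_cases hkj : k = j
  · subst hkj
    rw [hv, pow_zero, mul_one, h1]
    exact pow_ne_zero _ (mul_ne_zero h2 haj)
  · exact mul_ne_zero (pow_ne_zero _ (hk k hkj).2) (pow_ne_zero _ (hk k hkj).1)

theorem prod_zpow_eq_one_iff {p : ι → ℕ} (hp : ∀ k, (p k).Prime ∧ p k % 4 = 1)
    (hinj : Function.Injective p) {a b : ι → ℤ} (ha : ∀ k, 0 < a k)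
    (hab : ∀ k, a k ^ 2 + b k ^ 2 = p k) (e : ι → ℤ) :
    ∏ k, (((a k : ℂ) + (b k : ℂ) * Complex.I) / ((a k : ℂ) - (b k : ℂ) * Complex.I)) ^ e k = 1 ↔
      e = 0 := by
  refine ⟨fun h => ?_, fun h => by simp [h]⟩
  set z : ι → GaussianInt := fun k => ⟨a k, b k⟩ with hz
  set w : ι → GaussianInt := fun k => ⟨a k, -b k⟩ with hw
  have hzC : ∀ k, (a k : ℂ) + (b k : ℂ) * Complex.I = toComplex (z k) := fun k => by
    simp [hz, toComplex_def₂, Complex.ext_iff]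
  have hwC : ∀ k, (a k : ℂ) - (b k : ℂ) * Complex.I = toComplex (w k) := fun k => by
    simp [hw, toComplex_def₂, Complex.ext_iff]
  have hz0 : ∀ k, toComplex (z k) ≠ 0 := fun k => by
    rw [Ne, toComplex_eq_zero]
    exact fun h => (ha k).ne' (congrArg Zsqrtd.re h)
  have hw0 : ∀ k, toComplex (w k) ≠ 0 := fun k => by
    rw [Ne, toComplex_eq_zero]
    exact fun h => (ha k).ne' (congrArg Zsqrtd.re h)
  -- Splitting the exponents into positive and negative parts clears denominators and moves the
  -- relation into ℤ[i].
  have key : ∏ k, (z k ^ (e k).toNat * w k ^ (-e k).toNat) =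
      ∏ k, (w k ^ (e k).toNat * z k ^ (-e k).toNat) := by
    apply toComplex_injective
    simp only [map_prod, map_mul, map_pow]
    rw [← div_eq_one_iff_eq (Finset.prod_ne_zero_iff.2 fun k _ =>
      mul_ne_zero (pow_ne_zero _ (hw0 k)) (pow_ne_zero _ (hz0 k))), ← Finset.prod_div_distrib, ← h]
    refine Finset.prod_congr rfl fun k _ => ?_
    rw [hzC, hwC]
    obtain ⟨n, hn⟩ := Int.eq_nat_or_neg (e k)
    have h1 := hz0 k
    have h2 := hw0 k
    rcases hn with hn | hn
    · rw [hn]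
      simp [div_pow]
    · rw [hn]
      simp [div_pow]
  funext j
  by_contra hj
  have hj : e j ≠ 0 := hj
  rcases lt_or_gt_of_ne hj with hj | hj
  · refine prod_gaussian_ne hp hinj ha hab (u := fun k => (-e k).toNat)
      (v := fun k => (e k).toNat) (j := j) (by simp; omega) (by simp; omega) ?_
    simpa only [mul_comm] using key.symm
  · exact prod_gaussian_ne hp hinj ha hab (u := fun k => (e k).toNat)
      (v := fun k => (-e k).toNat) (j := j) (by simp; omega) (by simp; omega) key

/-- The point `(a + b i) / (a - b i)`, written as a pair of rational numbers. -/
def gaussianPoint (a b : ℕ) : ℚ × ℚ :=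
  (((a ^ 2 - b ^ 2 : ℕ) : ℚ) / ((a ^ 2 + b ^ 2 : ℕ) : ℚ),
    ((2 * a * b : ℕ) : ℚ) / ((a ^ 2 + b ^ 2 : ℕ) : ℚ))

theorem ratPointToComplex_gaussianPoint {a b : ℕ} (hb : 0 < b) (hab : b < a) :
    ratPointToComplex (gaussianPoint a b) =
      (((a : ℤ) : ℂ) + ((b : ℤ) : ℂ) * Complex.I) / (((a : ℤ) : ℂ) - ((b : ℤ) : ℂ) * Complex.I) := by
  have h1 : ((a : ℂ) - (b : ℂ) * Complex.I) ≠ 0 := by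
    intro h
    have := congrArg Complex.re h
    simp at this
    omega
  have h2 : ((a : ℂ) ^ 2 + (b : ℂ) ^ 2) ≠ 0 := by
    have : a ^ 2 + b ^ 2 ≠ 0 := by positivity
    exact_mod_cast this
  have h3 : b ^ 2 ≤ a ^ 2 := Nat.pow_le_pow_left hab.le 2
  simp only [ratPointToComplex, gaussianPoint]
  push_cast [h3]
  rw [eq_div_iff h1]
  field_simp
  linear_combination (-2 * (a : ℂ) * b ^ 2) * Complex.I_sq

theorem norm_ratPointToComplex_gaussianPoint {a b : ℕ} (hb : 0 < b) (hab : b < a) :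
    ‖ratPointToComplex (gaussianPoint a b)‖ = 1 := by
  rw [ratPointToComplex_gaussianPoint hb hab, norm_div]
  have h1 : (((a : ℤ) : ℂ) - ((b : ℤ) : ℂ) * Complex.I) =
      (starRingEnd ℂ) (((a : ℤ) : ℂ) + ((b : ℤ) : ℂ) * Complex.I) := by
    simp [Complex.ext_iff]
  rw [h1, Complex.norm_conj]
  refine div_self (norm_ne_zero_iff.2 fun h => ?_)
  have := congrArg Complex.re h
  simp at this
  omega

theorem encodeRat_natCast_div {x p : ℕ} (hp : p.Prime) (hx : 0 < x) (hxp : x < p) :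
    encodeRat ((x : ℚ) / p) =
      Γ'.bit false :: encodeNatBits x ++ Γ'.comma :: encodeNatBits p := by
  have hc : Nat.Coprime x p :=
    ((Nat.Prime.coprime_iff_not_dvd hp).2 (Nat.not_dvd_of_pos_of_lt hx hxp)).symm
  have h0 : (0 : ℤ) < p := by exact_mod_cast hp.pos
  have h1 : ((x : ℚ) / p).num = x := by
    simpa using Rat.num_div_eq_of_coprime (a := x) h0 (by simpa using hc)
  have h2 : ((x : ℚ) / p).den = p := by
    simpa using Rat.den_div_eq_of_coprime (a := x) h0 (by simpa using hc)
  have h3 : ¬ (x : ℚ) / p < 0 := not_lt.2 (by positivity)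
  simp [encodeRat, h1, h2, h3]

/-- The order 0 < b < a makes both numerators positive and smaller than p (for 2ab because (a - b)²
> 0). So the fractions are already in lowest terms with denominator p, and the program never has to
compute a gcd or a sign. -/
theorem encodeRatPoint_gaussianPoint {a b p : ℕ} (hp : p.Prime) (hb : 0 < b) (hab : b < a)
    (h : a ^ 2 + b ^ 2 = p) :
    encodeRatPoint (gaussianPoint a b) =
      Γ'.bra :: (Γ'.bit false :: encodeNatBits (a ^ 2 - b ^ 2) ++ Γ'.comma :: encodeNatBits p) ++
        Γ'.comma :: ((Γ'.bit false :: encodeNatBits (2 * a * b) ++ Γ'.comma :: encodeNatBits p) ++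
          [Γ'.ket]) := by
  have h1 : b ^ 2 < a ^ 2 := Nat.pow_lt_pow_left hab (by norm_num)
  have h2 : 0 < b ^ 2 := by positivity
  have h3 : 0 < 2 * a * b := by
    have : 0 < a := by omega
    positivity
  have h4 : 2 * a * b < p := by
    obtain ⟨c, rfl⟩ := Nat.exists_eq_add_of_lt hab
    rw [← h]
    nlinarith
  unfold encodeRatPoint gaussianPoint
  rw [h, encodeRat_natCast_div hp (by omega) (by omega), encodeRat_natCast_div hp h3 h4]

theorem exists_sq_add_sq {p : ℕ} (hp : p.Prime) (h4 : p % 4 = 1) :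
    ∃ a b : ℕ, b < a ∧ a < p ∧ a ^ 2 + b ^ 2 = p := by
  have := Fact.mk hp
  obtain ⟨a, b, h⟩ := Nat.Prime.sq_add_sq (p := p) (by omega)
  have hlt : ∀ {a b : ℕ}, b < a → a ^ 2 + b ^ 2 = p → a < p := by
    intro a b hab h
    rcases Nat.lt_or_ge a 2 with ha | ha
    · exact ha.trans_le hp.two_le
    · nlinarith
  rcases lt_trichotomy a b with hab | hab | hab
  · exact ⟨b, a, hab, hlt hab (by omega), by omega⟩
  · subst hab
    omega
  · exact ⟨a, b, hab, hlt hab h, h⟩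

theorem pos_of_sq_add_sq {p a b : ℕ} (hp : p.Prime) (h : a ^ 2 + b ^ 2 = p) : 0 < b := by
  rcases Nat.eq_zero_or_pos b with rfl | hb
  · exact absurd (h ▸ hp) (by simpa using Nat.Prime.not_prime_pow (x := a) (n := 2) le_rfl)
  · exact hb

end GaussianPoints

/-! ### Binary digits, lowest first -/

theorem encodeNat_eq_cons {n : ℕ} (hn : n ≠ 0) :
    encodeNat n = decide (n % 2 = 1) :: encodeNat (n / 2) := by
  have key : ∀ b m, Nat.bit b m ≠ 0 → encodeNat (Nat.bit b m) = b :: encodeNat m := by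
    intro b m h
    unfold encodeNat
    rw [← Num.ofNat'_eq, ← Num.ofNat'_eq, Num.ofNat'_bit]
    rcases hm : Num.ofNat' m with _ | k
    · cases b
      · have : m = 0 := by
          have := congrArg (fun k : Num => (k : ℕ)) hm
          simpa [Num.ofNat'_eq] using this
        simp [this] at h
      · rfl
    · cases b <;> rfl
  have h2 := Nat.bit_bodd_div2 n
  rw [Nat.div2_val] at h2
  have h1 := key (Nat.bodd n) (n / 2) (by rw [h2]; exact hn)
  rw [h2] at h1
  rw [h1]
  congr 1
  rcases hb : Nat.bodd n <;> simp [Nat.mod_two_of_bodd, hb]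

theorem encodeNatBits_eq_cons {n : ℕ} (hn : n ≠ 0) :
    encodeNatBits n = Γ'.bit (decide (n % 2 = 1)) :: encodeNatBits (n / 2) := by
  rw [encodeNatBits, encodeNat_eq_cons hn]
  rfl

/-! ### The program that computes the points -/

namespace CounterProgram

open Finset

namespace Expr

theorem sum_ite_lt {k N : ℕ} (h : k ≤ N) : ∑ u ∈ range N, (if u < k then 1 else 0) = k := by
  rw [sum_boole, Nat.cast_id]
  have : {u ∈ range N | u < k} = range k := by
    ext u
    simp only [mem_filter, mem_range]
    omega
  rw [this, card_range]

/-- The indicator of the equality of the values. -/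
def eq (e f : Expr) : Expr := sub (const 1) (add (sub e f) (sub f e))

@[simp] theorem eval_eq (e f : Expr) (s : ℕ → ℕ) :
    (eq e f).eval s = if e.eval s = f.eval s then 1 else 0 := by
  simp only [eq, eval]
  split_ifs <;> omega

/-- The indicator of the value being zero. -/
def not (e : Expr) : Expr := sub (const 1) e

@[simp] theorem eval_not (e : Expr) (s : ℕ → ℕ) :
    (not e).eval s = if e.eval s = 0 then 1 else 0 := by
  simp only [not, eval]
  split_ifs <;> omega

/-- Bounded search for the first natural number where `f` does not vanish. -/
def bsearch (f : ℕ → ℕ) (N : ℕ) : ℕ :=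
  ∑ u ∈ range N, if ∑ v ∈ range (u + 1), f v = 0 then 1 else 0

/-- The u for which f vanishes on 0, …, u are those below the first nonzero place, so counting them
gives that place. -/
theorem bsearch_spec {f : ℕ → ℕ} {N : ℕ} (h : ∃ m < N, f m ≠ 0) :
    f (bsearch f N) ≠ 0 ∧ bsearch f N < N := by
  obtain ⟨m, hm, hf⟩ := h
  have hex : ∃ m, f m ≠ 0 := ⟨m, hf⟩
  have hle : Nat.find hex ≤ m := Nat.find_min' hex hf
  have : bsearch f N = Nat.find hex := by
    rw [bsearch, ← sum_ite_lt (k := Nat.find hex) (N := N) (by omega)]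
    refine sum_congr rfl fun u _ => if_congr ?_ rfl rfl
    rw [Nat.lt_find_iff]
    simp
  rw [this]
  exact ⟨Nat.find_spec hex, by omega⟩

/-- The expression for a bounded search with the variable `v`; the variable `u` is auxiliary. -/
def search (u v : ℕ) (f e : Expr) : Expr :=
  sum u e (not (sum v (add (var u) (const 1)) f))

theorem eval_search {u v : ℕ} {f e : Expr} {s : ℕ → ℕ} {g : ℕ → ℕ}
    (hf : ∀ i j, f.eval (Function.update (Function.update s u i) v j) = g j) :
    (search u v f e).eval s = bsearch g (e.eval s) := by
  simp [search, eval, bsearch, hf]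

/-- The indicator of the variable `10` being a prime congruent to `1` modulo `4`. -/
def primeTest : Expr :=
  mul (not (sum 11 (var 10) (sum 12 (var 10) (eq (mul (var 11) (var 12)) (var 10)))))
    (not (not (sum 11 (var 10) (eq (add (mul (const 4) (var 11)) (const 5)) (var 10)))))

/-- Writing m as 4e + 5 instead of 4e + 1 excludes m = 1, and with it all m below 5. -/
theorem prime_one_mod_four_iff (m : ℕ) :
    ((∀ d < m, ∀ e < m, d * e ≠ m) ∧ ∃ e < m, 4 * e + 5 = m) ↔ m.Prime ∧ m % 4 = 1 := by
  constructor
  · rintro ⟨h, e, he, hm⟩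
    refine ⟨?_, by omega⟩
    rw [Nat.prime_def_lt]
    refine ⟨by omega, fun d hd hdvd => ?_⟩
    by_contra hd1
    obtain ⟨c, hc⟩ := hdvd
    have hd0 : d ≠ 0 := by rintro rfl; omega
    refine h d hd c ?_ hc.symm
    have : c ≠ 0 := by rintro rfl; omega
    rw [hc]
    have : 2 ≤ d := by omega
    nlinarith [Nat.pos_of_ne_zero ‹c ≠ 0›]
  · rintro ⟨hp, hm⟩
    refine ⟨fun d hd e he h => ?_, ⟨(m - 5) / 4, ?_, ?_⟩⟩
    · rcases (Nat.dvd_prime hp).1 (Dvd.intro e h) with rfl | rfl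
      · omega
      · omega
    · have := hp.two_le
      omega
    · have := hp.two_le
      omega

theorem eval_primeTest (s : ℕ → ℕ) :
    primeTest.eval s = if (s 10).Prime ∧ s 10 % 4 = 1 then 1 else 0 := by
  rw [← if_congr (prime_one_mod_four_iff (s 10)) rfl rfl]
  by_cases h1 : ∀ d < s 10, ∀ e < s 10, d * e ≠ s 10 <;>
    by_cases h2 : ∃ e < s 10, 4 * e + 5 = s 10 <;>
      simp [primeTest, eval, h1, h2]

/-- A bound for the prime number with the index given by the variable `1`. -/
def primeBound : Expr :=
  let t := add (var 1) (const 100)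
  let u := mul (mul t t) (mul t t)
  add (mul (const 4) (mul u (mul u u))) (const 2)

theorem eval_primeBound (s : ℕ → ℕ) : primeBound.eval s = 4 * (s 1 + 100) ^ 12 + 2 := by
  simp only [primeBound, eval]
  ring

/-- The prime number congruent to `1` modulo `4` with the index given by the variable `1`. -/
def prime : Expr :=
  sum 13 primeBound (not (sub (sum 10 (add (var 13) (const 1)) primeTest) (var 1)))

@[simp] theorem eval_prime (s : ℕ → ℕ) : prime.eval s = primeOneModFour (s 1) := by
  rw [← sum_ite_lt (primeOneModFour_lt (s 1)).le, ← eval_primeBound s]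
  simp only [prime, eval]
  refine sum_congr rfl fun m _ => ?_
  simp only [eval_not, eval, eval_primeTest, Function.update_self, ne_eq,
    OfNat.one_ne_ofNat, not_false_eq_true,
    Function.update_of_ne, Nat.sub_eq_zero_iff_le]
  refine if_congr ?_ rfl rfl
  -- A number m lies below the j-th prime exactly if at most j of these primes are ≤ m; the prime is
  -- obtained by counting such m.
  rw [primeOneModFour, ← Nat.succ_le_iff, ← Nat.count_le_iff_le_nth infinite_primes_one_mod_four,
    Nat.count_eq_card_filter_range, sum_boole, Nat.cast_id]

/-- The larger one of two numbers whose squares add up to `p`. -/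
def _root_.largeLeg (p : ℕ) : ℕ :=
  bsearch (fun a => ∑ b ∈ range a, if a * a + b * b = p then 1 else 0) p

/-- The smaller one of two numbers whose squares add up to `p`. -/
def _root_.smallLeg (p : ℕ) : ℕ :=
  bsearch (fun b => if largeLeg p * largeLeg p + b * b = p then 1 else 0) (largeLeg p)

theorem _root_.largeLeg_sq_add_smallLeg_sq {p : ℕ} (hp : p.Prime) (h4 : p % 4 = 1) :
    largeLeg p ^ 2 + smallLeg p ^ 2 = p ∧ smallLeg p < largeLeg p := by
  obtain ⟨a, b, hba, hap, h⟩ := exists_sq_add_sq hp h4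
  have h1 := bsearch_spec (f := fun a => ∑ b ∈ range a, if a * a + b * b = p then 1 else 0)
    (N := p) ⟨a, hap, fun h0 => by
      have := sum_eq_zero_iff.1 h0 b (mem_range.2 hba)
      simp [← pow_two, h] at this⟩
  obtain ⟨b', hb', h2⟩ := exists_ne_zero_of_sum_ne_zero h1.1
  have h3 := bsearch_spec (f := fun b => if largeLeg p * largeLeg p + b * b = p then 1 else 0)
    (N := largeLeg p) ⟨b', mem_range.1 hb', h2⟩
  refine ⟨?_, h3.2⟩
  have h5 := h3.1
  simp only [ne_eq, ite_eq_right_iff, one_ne_zero, imp_false, not_not] at h5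
  rw [pow_two, pow_two]
  exact h5

/-- The expression for the larger leg for the prime number with the index in the variable `1`. -/
def legA : Expr :=
  search 16 14 (sum 15 (var 14)
    (eq (add (mul (var 14) (var 14)) (mul (var 15) (var 15))) prime)) prime

@[simp] theorem eval_legA (s : ℕ → ℕ) : legA.eval s = largeLeg (primeOneModFour (s 1)) := by
  rw [legA, eval_search (g := fun a => ∑ b ∈ range a,
    if a * a + b * b = primeOneModFour (s 1) then 1 else 0), eval_prime, largeLeg]
  intro i j
  simp [eval]

/-- The expression for the smaller leg for the prime number with the index in the variable `1`. -/
def legB : Expr :=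
  search 16 14 (eq (add (mul legA legA) (mul (var 14) (var 14))) prime) legA

@[simp] theorem eval_legB (s : ℕ → ℕ) : legB.eval s = smallLeg (primeOneModFour (s 1)) := by
  rw [legB, eval_search (g := fun b => if largeLeg (primeOneModFour (s 1)) *
    largeLeg (primeOneModFour (s 1)) + b * b = primeOneModFour (s 1) then 1 else 0), eval_legA,
    smallLeg]
  intro i j
  simp [eval]

/-- Half of the variable `2`, rounded down. -/
def half : Expr := sum 15 (var 2) (not (sub (add (mul (const 2) (var 15)) (const 2)) (var 2)))

@[simp] theorem eval_half (s : ℕ → ℕ) : half.eval s = s 2 / 2 := by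
  rw [← sum_ite_lt (Nat.div_le_self (s 2) 2)]
  simp only [half, eval]
  refine sum_congr rfl fun k _ => ?_
  simp only [eval_not, eval, Function.update_self, ne_eq,
    Nat.reduceEqDiff, not_false_eq_true,
    Function.update_of_ne, Nat.sub_eq_zero_iff_le]
  exact if_congr (by omega) rfl rfl

end Expr

namespace Prog

open CounterProgram.Expr

/-- Emit the lowest bit of the variable `2` and divide the variable by two. -/
def emitBit : Prog :=
  seq (rep (sub (var 2) (mul (const 2) half)) (emit (Γ'.bit true)))
    (seq (rep (sub (not (not (var 2))) (sub (var 2) (mul (const 2) half))) (emit (Γ'.bit false)))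
      (assign 2 half))

/-- Emit the value of an expression in binary. -/
def emitBits (e : Expr) : Prog :=
  seq (assign 2 e) (rep (var 2) emitBit)

/-- Run a nonempty list of programs one after the other. -/
def seqs (P : Prog) : List Prog → Prog
  | [] => P
  | Q :: l => seq P (seqs Q l)

theorem run_emitBit (s : State ℕ) : emitBit.run s =
    ⟨Function.update s.ctr 2 (s.ctr 2 / 2),
      (if s.ctr 2 = 0 then [] else [Γ'.bit (decide (s.ctr 2 % 2 = 1))]) ++ s.out⟩ := by
  have h : s.ctr 2 - 2 * (s.ctr 2 / 2) = s.ctr 2 % 2 := by omega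
  rcases Nat.eq_zero_or_pos (s.ctr 2) with h0 | h0
  · simp [emitBit, run, eval, h0, State.set]
  · rcases Nat.mod_two_eq_zero_or_one (s.ctr 2) with h1 | h1 <;>
      simp [emitBit, run, eval, h, h0.ne', h1, State.set]

theorem bdd_emitBit {s : State ℕ} {B : ℕ} (h : s.ctr 2 ≤ B) : emitBit.Bdd B s := by
  have h1 : ∀ g e (s : State ℕ), ((rep e (emit g)).run s).ctr = s.ctr := by
    intro g e s
    simp only [run]
    induction e.eval s.ctr with
    | zero => rfl
    | succ k ih => rw [Function.iterate_succ_apply']; exact ih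
  refine ⟨fun _ _ => trivial, fun _ _ => trivial, ?_⟩
  simp only [Bdd]
  rw [eval_half, h1, h1]
  omega

/-- Once the variable `2` is zero, further rounds emit nothing. So the value itself serves as the
number of rounds in `emitBits`, and no bit length is needed. -/
theorem iterate_emitBit (k : ℕ) : ∀ s : State ℕ, s.ctr 2 ≤ k → emitBit.run^[k] s =
    ⟨Function.update s.ctr 2 0, (encodeNatBits (s.ctr 2)).reverse ++ s.out⟩ := by
  induction k with
  | zero =>
    intro s hs
    have h0 : s.ctr 2 = 0 := by omega
    rw [h0]
    ext j
    · by_cases h : j = 2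
      · subst h; simp [h0]
      · simp [h]
    · simp [encodeNatBits, encodeNat, encodeNum]
  | succ k ih =>
    intro s hs
    rw [Function.iterate_succ_apply, ih _ (by rw [run_emitBit]; simp; omega), run_emitBit]
    by_cases h0 : s.ctr 2 = 0
    · simp [h0]
    · simp only [Function.update_self, Function.update_idem, h0, if_false,
        encodeNatBits_eq_cons h0, List.reverse_cons, List.append_assoc]

theorem iterate_emitBit_le (k : ℕ) (s : State ℕ) : (emitBit.run^[k] s).ctr 2 ≤ s.ctr 2 := by
  induction k with
  | zero => exact le_rfl
  | succ k ih =>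
    rw [Function.iterate_succ_apply', run_emitBit]
    simp only [Function.update_self]
    omega

theorem run_emitBits (e : Expr) (s : State ℕ) : (emitBits e).run s =
    ⟨Function.update s.ctr 2 0, (encodeNatBits (e.eval s.ctr)).reverse ++ s.out⟩ := by
  simp only [emitBits, run]
  rw [iterate_emitBit _ _ (by simp [eval])]
  simp

theorem bdd_emitBits {e : Expr} {s : State ℕ} {B : ℕ} (h : e.eval s.ctr ≤ B) :
    (emitBits e).Bdd B s := by
  refine ⟨h, fun k _ => bdd_emitBit ((iterate_emitBit_le k _).trans ?_)⟩
  simpa [run] using h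

/-- The expression for the numerator of the real part. -/
def reNum : Expr := sub (mul legA legA) (mul legB legB)

/-- The expression for the numerator of the imaginary part. -/
def imNum : Expr := mul (mul (const 2) legA) legB

/-- Emit the point for the index in the variable `1` and increase this variable. -/
def emitPoint : Prog :=
  seqs (emit Γ'.bra) [emit (Γ'.bit false), emitBits reNum, emit Γ'.comma, emitBits prime,
    emit Γ'.comma, emit (Γ'.bit false), emitBits imNum, emit Γ'.comma, emitBits prime,
    emit Γ'.ket, assign 1 (add (var 1) (const 1))]

/-- The point for the `j`-th prime number congruent to `1` modulo `4`. -/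
noncomputable def _root_.primePoint (j : ℕ) : ℚ × ℚ :=
  gaussianPoint (largeLeg (primeOneModFour j)) (smallLeg (primeOneModFour j))

theorem run_emitPoint (s : State ℕ) : emitPoint.run s =
    ⟨Function.update (Function.update s.ctr 2 0) 1 (s.ctr 1 + 1),
      (encodeRatPoint (primePoint (s.ctr 1))).reverse ++ s.out⟩ := by
  obtain ⟨hp, h4⟩ := primeOneModFour_spec (s.ctr 1)
  obtain ⟨h1, h2⟩ := largeLeg_sq_add_smallLeg_sq hp h4
  rw [primePoint, encodeRatPoint_gaussianPoint hp (pos_of_sq_add_sq hp h1) h2 h1]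
  simp [emitPoint, seqs, run, run_emitBits, reNum, imNum, eval, State.set, pow_two]

/-- Everything assigned is at most the current prime, except for the incremented index, which the
same bound covers. -/
theorem bdd_emitPoint {s : State ℕ} {B : ℕ} (h : 4 * (s.ctr 1 + 100) ^ 12 + 2 ≤ B) :
    emitPoint.Bdd B s := by
  obtain ⟨hp, h4⟩ := primeOneModFour_spec (s.ctr 1)
  obtain ⟨h1, h2⟩ := largeLeg_sq_add_smallLeg_sq hp h4
  have h3 := primeOneModFour_lt (s.ctr 1)
  have h5 : s.ctr 1 + 100 ≤ (s.ctr 1 + 100) ^ 12 := Nat.le_self_pow (by norm_num) _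
  have h6 : 2 * largeLeg (primeOneModFour (s.ctr 1)) * smallLeg (primeOneModFour (s.ctr 1)) ≤
      primeOneModFour (s.ctr 1) := by
    obtain ⟨c, hc⟩ := Nat.exists_eq_add_of_lt h2
    rw [hc] at h1 ⊢
    nlinarith
  have h7 : largeLeg (primeOneModFour (s.ctr 1)) * largeLeg (primeOneModFour (s.ctr 1)) ≤
      primeOneModFour (s.ctr 1) := by
    rw [← pow_two]
    omega
  have hr : reNum.eval s.ctr ≤ B := by
    simp only [reNum, eval, eval_legA, eval_legB]
    omega
  have hi : imNum.eval s.ctr ≤ B := by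
    simp only [imNum, eval, eval_legA, eval_legB]
    omega
  refine ⟨trivial, trivial, bdd_emitBits hr, trivial, bdd_emitBits ?_, trivial, trivial,
    bdd_emitBits ?_, trivial, bdd_emitBits ?_, trivial, ?_⟩
  · simp [run, run_emitBits]
    omega
  · simp [run, run_emitBits, imNum, eval] at hi ⊢
    exact hi
  · simp [run, run_emitBits]
    omega
  · simp [run, run_emitBits, seqs, Bdd, eval]
    omega

/-- The program that emits as many points as the variable `0` says. -/
def emitPoints : Prog := rep (var 0) emitPoint

theorem iterate_emitPoint (n k : ℕ) :
    emitPoint.run^[k] ⟨Function.update (fun _ => 0) 0 n, []⟩ =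
      ⟨Function.update (Function.update (fun _ => 0) 0 n) 1 k,
        (encodeRatPoints ((List.range k).map primePoint)).reverse⟩ := by
  induction k with
  | zero =>
    ext j
    · by_cases h : j = 1
      · subst h; simp
      · simp [h]
    · simp [encodeRatPoints]
  | succ k ih =>
    rw [Function.iterate_succ_apply', ih, run_emitPoint]
    ext j
    · simp only [Function.update_apply]
      split_ifs <;> simp_all
    · simp [encodeRatPoints, List.range_succ]

end Prog

theorem computableInPolyTime_primePoint :
    Nonempty (Turing.TM2ComputableInPolyTime unaryEncodeNat encodeRatPoints
      (fun n => List.ofFn (fun j : Fin n => primePoint j))) := by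
  refine Prog.emitPoints.computableInPolyTime (4 * (Polynomial.X + 100) ^ 12 + 2) (fun n k hk => ?_)
    fun n => ?_
  · have hk' : k < n := hk
    refine Prog.bdd_emitPoint ?_
    rw [Prog.iterate_emitPoint]
    simp
    gcongr
  · change (Prog.emitPoint.run^[n] _).out.reverse = _
    rw [Prog.iterate_emitPoint, List.reverse_reverse]
    congr 1
    rw [List.ofFn_eq_map, ← List.map_coe_finRange_eq_range, List.map_map]
    rfl

end CounterProgram

/-! ### The main theorem -/

theorem mainTheorem9 :
    ∃ q : (n : ℕ) → Fin n → ℚ × ℚ,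
      Nonempty (Turing.TM2ComputableInPolyTime unaryEncodeNat encodeRatPoints
        (fun n => List.ofFn (q n))) ∧
      ∀ n : ℕ,
        (∀ j : Fin n, ‖ratPointToComplex (q n j)‖ = 1) ∧
        (∀ e : Fin n → ℤ, (∏ j, ratPointToComplex (q n j) ^ e j = 1) ↔ e = 0) ∧
        (∀ j : Fin n, ∃ a b : ℤ, 0 < a ∧ a ^ 2 + b ^ 2 = (primeOneModFour j : ℤ) ∧
          ratPointToComplex (q n j) =
            ((a : ℂ) + (b : ℂ) * Complex.I) / ((a : ℂ) - (b : ℂ) * Complex.I)) := by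
  have hleg : ∀ j, largeLeg (primeOneModFour j) ^ 2 + smallLeg (primeOneModFour j) ^ 2 =
      primeOneModFour j ∧ smallLeg (primeOneModFour j) < largeLeg (primeOneModFour j) := fun j =>
    largeLeg_sq_add_smallLeg_sq (primeOneModFour_spec j).1 (primeOneModFour_spec j).2
  have hpos : ∀ j, 0 < smallLeg (primeOneModFour j) := fun j =>
    pos_of_sq_add_sq (primeOneModFour_spec j).1 (hleg j).1
  have hpoint := fun j => ratPointToComplex_gaussianPoint (hpos j) (hleg j).2
  refine ⟨fun n j => primePoint j, CounterProgram.computableInPolyTime_primePoint, fun n =>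
    ⟨fun j => norm_ratPointToComplex_gaussianPoint (hpos j) (hleg j).2, fun e => ?_, fun j =>
      ⟨largeLeg (primeOneModFour j), smallLeg (primeOneModFour j), ?_, ?_, hpoint j⟩⟩⟩
  · simp only [primePoint, hpoint]
    exact prod_zpow_eq_one_iff (p := fun k : Fin n => primeOneModFour k)
      (fun k => primeOneModFour_spec k)
      (fun k l h => Fin.ext (primeOneModFour_injective h))
      (a := fun k => (largeLeg (primeOneModFour k) : ℤ))
      (b := fun k => (smallLeg (primeOneModFour k) : ℤ))
      (fun k => by
        have := (hleg k).2
        simp only [Int.natCast_pos]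
        omega) (fun k => by exact_mod_cast (hleg k).1) e
  · have := (hleg j).2
    omega
  · exact_mod_cast (hleg j).1
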